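/- Let $A,B:\mathbb{R}\to\mathbb{R}^{n\times n}$ be continuous and $1$-periodic, and let $\tau\in[0,1)$. For $N\in\mathbb{N}$, $N\ge 1$, let $M_N$ be the time-$1$ map of the linear delay differential equation $$\dot x(t)=A(t)x(t)+B(t)x(t-\tau-N),$$ that is, $M_N:C([-\tau-N,0];\mathbb{C}^n)\to C([-\tau-N,0];\mathbb{C}^n)$, $(M_N\varphi)(s)=x(1+s)$, where $x$ is the solution for $t\in[0,1]$ with history $x=\varphi$ on $[-\tau-N,0]$. A number $\mu\in\mathbb{C}$ is a Floquet exponent of $M_N$ if $e^{\mu}$ is an eigenvalue of $M_N$; its multiplicity is the algebraic multiplicity $\dim\bigcup_{j}\ker(M_N-e^{\mu})^j$ of that eigenvalue. The number $\mu$ is in the resolvent set of $M_N$ if $e^{\mu}I-M_N$ is an isomorphism. The characteristic function $h$ is defined as follows. Let $\|A\|_\infty=\max_{t\in[-1,0]}\|A(t)\|_\infty$ and similarly for $B$. Fix $R>0$ and an integer $m>\max\{\|A\|_\infty+R,\ \|B\|_\infty e^{1+R}\}$, and put $t_j=-1+j/m$. Let $U(t,s,\mu)$ be the propagation matrix of $\dot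 y=[A(t)-\mu I]y$. For $\operatorname{Re}\mu\ge -R$, $|z|\le e^{R}$ and $v=(v_0,\dots,v_{m-1})\in\mathbb{C}^{nm}$, let $y:[-1,0]\to\mathbb{C}^n$ be the unique function that is continuous on each of $[t_0,t_1),\dots,[t_{m-2},t_{m-1}),[t_{m-1},0]$, has left limits at $t_1,\dots,t_m$, and satisfies, for $t$ in the $j$-th of these intervals ($j=0,\dots,m-1$), $$y(t)=U(t,t_j,\mu)v_j+z\int_{t_j}^{t}U(t,s,\mu)B(s)\,y\big((s-\tau)_{\mathrm{mod}[-1,0]}\big)\,ds,$$ where $r_{\mathrm{mod}[-1,0]}$ is the representative of $r$ modulo $1$ in $[-1,0)$. Let $\Delta(\mu,z)\in\mathbb{C}^{nm\times nm}$ be the matrix of the linear map $$v\mapsto\Big(v_0-y(0),\ v_1-\lim_{t\nearrow t_1}y(t),\ \dots,\ v_{m-1}-\lim_{t\nearrow t_{m-1}}y(t)\Big),$$ and let $h(\mu,z)=\det\Delta(\mu,z)$. **Lemma (Convergence to strongly unstable spectrum).** Let $\operatorname{Re}\mu_0>0$. 1. If $h(\mu_0,0)\neq 0$, then there exists $N_0$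 such that $\mu_0$ lies in the resolvent set of $M_N$ for all $N>N_0$. 2. If $\mu_0$ is a root of multiplicity $k\ge 1$ of the function $h(\cdot,0)$, then there is $\delta>0$ such that for every neighbourhood $U$ of $\mu_0$ contained in the ball $B_\delta(\mu_0)$ there exists $N_0$ (depending on $U$) such that, for all $N>N_0$, $U$ contains exactly $k$ Floquet exponents of $M_N$, counted with multiplicity (in particular finitely many, each of finite multiplicity). -/

import Mathlib

open Set Filter Topology
open scoped Matrix

noncomputable section

namespace DelayFloquet

/-- Neumann series of an operator whose powers decay factorially. -/
theorem exists_neumann {X : Type*} [NormedAddCommGroup X] [NormedSpace ℂ X] [CompleteSpace X]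
    (V₀ : X →ₗ[ℂ] X) (c : ℝ) (hc : 0 ≤ c)
    (h : ∀ (k : ℕ) (x : X), ‖(V₀ ^ k) x‖ ≤ c ^ k / k.factorial * ‖x‖) :
    ∃ S : X →L[ℂ] X, ∀ g, S g = g + V₀ (S g) := by
  obtain ⟨V, hV⟩ : ∃ V : X →L[ℂ] X, ∀ x, V x = V₀ x :=
    ⟨V₀.mkContinuous c fun x => by simpa using h 1 x, fun _ => rfl⟩
  have hVk : ∀ (k : ℕ) x, (V ^ k) x = (V₀ ^ k) x := by
    intro k
    induction k with
    | zero => intro x; rfl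
    | succ k ih =>
      intro x
      rw [pow_succ', pow_succ', Module.End.mul_apply, ← ih, ← hV, mul_apply_eq_comp]
  have hsum : Summable fun k : ℕ => V ^ k := by
    refine Summable.of_norm_bounded (Real.summable_pow_div_factorial c) fun k => ?_
    refine ContinuousLinearMap.opNorm_le_bound _ (by positivity) fun x => ?_
    rw [hVk]
    exact h k x
  refine ⟨∑' k : ℕ, V ^ k, fun g => ?_⟩
  have h1 := hsum.one_sub_mul_tsum_pow
  rw [sub_mul, one_mul, sub_eq_iff_eq_add] at h1
  rw [← hV]
  exact congrArg (fun T : X →L[ℂ] X => T g) h1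

/-- Solution operator of the linear Volterra equation `y t = g t + ∫ s in a..t, F s (y s)` on
`[a, b]`; used only to show that the objects defined below exist. -/
theorem exists_volterra {E : Type*} [NormedAddCommGroup E] [NormedSpace ℂ E] [CompleteSpace E]
    {a b : ℝ} (hab : a ≤ b) (F : ℝ → E →L[ℂ] E) (hF : Continuous F) :
    ∃ S : C(Icc a b, E) →L[ℂ] C(Icc a b, E), ∀ (g : C(Icc a b, E)) (t : Icc a b),
      S g t = g t + ∫ s in a..(t : ℝ), F s (IccExtend hab (S g) s) := by
  have hcont : ∀ x : C(Icc a b, E), Continuous fun s => F s (IccExtend hab x s) := fun x =>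
    hF.clm_apply (x.continuous.Icc_extend' (h := hab))
  obtain ⟨K, hK⟩ : ∃ K, ∀ s ∈ Icc a b, ‖F s‖ ≤ K :=
    (isCompact_Icc.exists_bound_of_continuousOn hF.continuousOn)
  have hK0 : 0 ≤ K := (norm_nonneg _).trans (hK a ⟨le_rfl, hab⟩)
  obtain ⟨V₀, hV₀⟩ : ∃ V₀ : C(Icc a b, E) →ₗ[ℂ] C(Icc a b, E),
      ∀ x t, V₀ x t = ∫ s in a..(t : ℝ), F s (IccExtend hab x s) := ⟨
    { toFun := fun x =>
        ⟨fun t => ∫ s in a..(t : ℝ), F s (IccExtend hab x s),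
          (intervalIntegral.continuous_primitive
            (fun c d => (hcont x).intervalIntegrable c d) a).comp continuous_subtype_val⟩
      map_add' := by
        intro x y
        ext1 t
        simp only [ContinuousMap.coe_mk, ContinuousMap.add_apply]
        rw [← intervalIntegral.integral_add ((hcont x).intervalIntegrable _ _)
          ((hcont y).intervalIntegrable _ _)]
        simp [IccExtend]
      map_smul' := by
        intro c x
        ext1 t
        simp only [ContinuousMap.coe_mk, ContinuousMap.smul_apply, RingHom.id_apply]
        rw [← intervalIntegral.integral_smul]
        simp [IccExtend] }, fun _ _ => rfl⟩
  have hpow : ∀ (k : ℕ) (x : C(Icc a b, E)) (t : Icc a b),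
      ‖(V₀ ^ k) x t‖ ≤ K ^ k * ((t : ℝ) - a) ^ k / k.factorial * ‖x‖ := by
    intro k
    induction k with
    | zero => intro x t; simpa using x.norm_coe_le_norm t
    | succ k ih =>
      intro x t
      rw [pow_succ', Module.End.mul_apply, hV₀]
      have h1 : ‖∫ s in a..(t : ℝ), F s (IccExtend hab ((V₀ ^ k) x) s)‖ ≤
          ∫ s in a..(t : ℝ), K * (K ^ k * (s - a) ^ k / k.factorial * ‖x‖) := by
        refine intervalIntegral.norm_integral_le_of_norm_le t.2.1 ?_
          (Continuous.intervalIntegrable (by fun_prop) _ _)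
        refine Filter.Eventually.of_forall fun s hs => ?_
        have hs' : s ∈ Icc a b := ⟨hs.1.le, hs.2.trans t.2.2⟩
        refine ((F s).le_opNorm _).trans ?_
        rw [IccExtend_of_mem hab _ hs']
        exact mul_le_mul (hK s hs') (ih x ⟨s, hs'⟩) (norm_nonneg _) hK0
      refine h1.trans (le_of_eq ?_)
      have h2 : ∀ s : ℝ, K * (K ^ k * (s - a) ^ k / k.factorial * ‖x‖) =
          (K ^ (k + 1) / k.factorial * ‖x‖) * (s - a) ^ k := fun s => by ring
      simp_rw [h2]
      rw [intervalIntegral.integral_const_mul,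
        intervalIntegral.integral_comp_sub_right (fun s => s ^ k) a, integral_pow]
      have : (k.factorial : ℝ) ≠ 0 := by positivity
      have h3 : (k : ℝ) + 1 ≠ 0 := by positivity
      rw [Nat.factorial_succ]
      push_cast
      field_simp
      simp
  have hba : 0 ≤ b - a := sub_nonneg.2 hab
  have hpow' : ∀ (k : ℕ) (x : C(Icc a b, E)),
      ‖(V₀ ^ k) x‖ ≤ (K * (b - a)) ^ k / k.factorial * ‖x‖ := by
    intro k x
    rw [ContinuousMap.norm_le _ (by positivity)]
    intro t
    refine (hpow k x t).trans ?_
    rw [mul_pow]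
    have := t.2.1
    have h0 : 0 ≤ (t : ℝ) - a := sub_nonneg.2 t.2.1
    have h1 : (t : ℝ) - a ≤ b - a := sub_le_sub_right t.2.2 a
    gcongr
  obtain ⟨S, hS⟩ := exists_neumann V₀ (K * (b - a)) (by positivity) hpow'
  refine ⟨S, fun g t => ?_⟩
  rw [← hV₀, ← ContinuousMap.add_apply, ← hS]

/-- A real matrix regarded as a complex one. -/
def toComplex {n : ℕ} (M : Matrix (Fin n) (Fin n) ℝ) : Matrix (Fin n) (Fin n) ℂ :=
  M.map fun x => (x : ℂ)

theorem continuous_toComplex {n : ℕ} {A : ℝ → Matrix (Fin n) (Fin n) ℝ} (hA : Continuous A) :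
    Continuous fun t => toComplex (A t) :=
  hA.matrix_map Complex.continuous_ofReal

theorem exists_clm {n : ℕ} {A : ℝ → Matrix (Fin n) (Fin n) ℂ} (hA : Continuous A) :
    ∃ F : ℝ → (Fin n → ℂ) →L[ℂ] (Fin n → ℂ), Continuous F ∧ ∀ t v, F t v = A t *ᵥ v := by
  let L : Matrix (Fin n) (Fin n) ℂ →ₗ[ℂ] ((Fin n → ℂ) →L[ℂ] (Fin n → ℂ)) :=
    LinearMap.toContinuousLinearMap.toLinearMap ∘ₗ Matrix.toLin'.toLinearMap
  exact ⟨fun t => L (A t), L.continuous_of_finiteDimensional.comp hA, fun t v => rfl⟩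

/-! ### The time-`1` map of `x'(t) = A(t) x(t) + B(t) x(t - r)` -/

/-- `x` solves `x'(t) = A(t) x(t) + B(t) x(t - r)` for `0 ≤ t ≤ 1` with history `φ` on `[-r, 0]`. -/
structure IsDDESolution {n : ℕ} (A B : ℝ → Matrix (Fin n) (Fin n) ℝ) (r : ℝ)
    (φ : C(Icc (-r) 0, Fin n → ℂ)) (x : ℝ → Fin n → ℂ) : Prop where
  continuousOn : ContinuousOn x (Icc (-r) 1)
  history : ∀ s : Icc (-r) 0, x s = φ s
  deriv : ∀ t ∈ Icc (0 : ℝ) 1,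
    HasDerivWithinAt x (toComplex (A t) *ᵥ x t + toComplex (B t) *ᵥ x (t - r)) (Icc 0 1) t

/-- `M` is the operator `φ ↦ x(1 + ·)` on `C([-r, 0]; ℂⁿ)`, where `x` is the solution with
history `φ`. -/
def IsTimeOneMap {n : ℕ} (A B : ℝ → Matrix (Fin n) (Fin n) ℝ) (r : ℝ)
    (M : C(Icc (-r) 0, Fin n → ℂ) →L[ℂ] C(Icc (-r) 0, Fin n → ℂ)) : Prop :=
  ∀ φ, ∃ x, IsDDESolution A B r φ x ∧ ∀ s : Icc (-r) 0, M φ s = x (1 + s)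

theorem exists_isTimeOneMap {n : ℕ} {A B : ℝ → Matrix (Fin n) (Fin n) ℝ} (hA : Continuous A)
    (hB : Continuous B) {r : ℝ} (hr : 1 ≤ r) : ∃ M, IsTimeOneMap A B r M := by
  obtain ⟨FA, hFA, hFA'⟩ := exists_clm (continuous_toComplex hA)
  obtain ⟨FB, hFB, hFB'⟩ := exists_clm (continuous_toComplex hB)
  have hr0 : -r ≤ 0 := by linarith
  obtain ⟨S, hS⟩ := exists_volterra zero_le_one FA hFA
  have hcont : ∀ φ : C(Icc (-r) 0, Fin n → ℂ),
      Continuous fun s : ℝ => FB s (IccExtend hr0 φ (s - r)) := fun φ =>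
    hFB.clm_apply ((φ.continuous.Icc_extend' (h := hr0)).comp (continuous_id.sub continuous_const))
  have hcont' : ∀ y : C(Icc (0 : ℝ) 1, Fin n → ℂ),
      Continuous fun s : ℝ => FA s (IccExtend zero_le_one y s) := fun y =>
    hFA.clm_apply (y.continuous.Icc_extend' (h := zero_le_one))
  let z : Icc (-r) 0 := ⟨0, hr0, le_rfl⟩
  obtain ⟨G₀, hG₀⟩ : ∃ G₀ : C(Icc (-r) 0, Fin n → ℂ) →ₗ[ℂ] C(Icc (0 : ℝ) 1, Fin n → ℂ),
      ∀ φ t, G₀ φ t = φ z + ∫ s in (0 : ℝ)..(t : ℝ), FB s (IccExtend hr0 φ (s - r)) := ⟨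
    { toFun := fun φ => ⟨fun t => φ z + ∫ s in (0 : ℝ)..(t : ℝ), FB s (IccExtend hr0 φ (s - r)),
        continuous_const.add ((intervalIntegral.continuous_primitive
            (fun c d => (hcont φ).intervalIntegrable c d) 0).comp continuous_subtype_val)⟩
      map_add' := by
        intro x y
        ext1 t
        simp only [ContinuousMap.coe_mk, ContinuousMap.add_apply]
        rw [add_add_add_comm, ← intervalIntegral.integral_add ((hcont x).intervalIntegrable _ _)
          ((hcont y).intervalIntegrable _ _)]
        simp [IccExtend]
      map_smul' := by
        intro c x
        ext1 t
        simp only [ContinuousMap.coe_mk, ContinuousMap.smul_apply, RingHom.id_apply]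
        rw [smul_add, ← intervalIntegral.integral_smul]
        simp [IccExtend] }, fun _ _ => rfl⟩
  obtain ⟨K, hK⟩ : ∃ K, ∀ s ∈ Icc (0 : ℝ) 1, ‖FB s‖ ≤ K :=
    isCompact_Icc.exists_bound_of_continuousOn hFB.continuousOn
  have hK0 : 0 ≤ K := (norm_nonneg _).trans (hK 0 ⟨le_rfl, zero_le_one⟩)
  have hGb : ∀ φ, ‖G₀ φ‖ ≤ (1 + K) * ‖φ‖ := by
    intro φ
    rw [ContinuousMap.norm_le _ (by positivity)]
    intro t
    rw [hG₀, add_mul, one_mul]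
    refine (norm_add_le _ _).trans (add_le_add (φ.norm_coe_le_norm z) ?_)
    refine (intervalIntegral.norm_integral_le_of_norm_le_const (C := K * ‖φ‖) ?_).trans ?_
    · intro s hs
      rw [uIoc_of_le t.2.1] at hs
      refine ((FB s).le_opNorm _).trans ?_
      exact mul_le_mul (hK s ⟨hs.1.le, hs.2.trans t.2.2⟩) (φ.norm_coe_le_norm _)
        (norm_nonneg _) hK0
    · rw [sub_zero, abs_of_nonneg t.2.1]
      exact mul_le_of_le_one_right (by positivity) t.2.2
  let y : C(Icc (-r) 0, Fin n → ℂ) → C(Icc (0 : ℝ) 1, Fin n → ℂ) := fun φ => S (G₀ φ)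
  have hy0 : ∀ φ, y φ ⟨0, le_rfl, zero_le_one⟩ = φ z := fun φ => by simp [y, hS, hG₀]
  have hMc : ∀ φ : C(Icc (-r) 0, Fin n → ℂ), Continuous fun t : ℝ =>
      if t ≤ 0 then IccExtend hr0 φ t else IccExtend zero_le_one (y φ) t := by
    intro φ
    refine Continuous.if_le (φ.continuous.Icc_extend' (h := hr0))
      ((y φ).continuous.Icc_extend' (h := zero_le_one)) continuous_id continuous_const ?_
    intro t ht
    have ht : t = 0 := ht
    subst ht
    rw [IccExtend_of_mem hr0 _ (x := 0) ⟨hr0, le_rfl⟩,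
      IccExtend_of_mem zero_le_one _ (x := 0) ⟨le_rfl, zero_le_one⟩]
    exact (hy0 φ).symm
  obtain ⟨M₀, hM₀⟩ : ∃ M₀ : C(Icc (-r) 0, Fin n → ℂ) →ₗ[ℂ] C(Icc (-r) 0, Fin n → ℂ),
      ∀ φ s, M₀ φ s = if 1 + (s : ℝ) ≤ 0 then IccExtend hr0 φ (1 + s)
        else IccExtend zero_le_one (y φ) (1 + s) := ⟨
    { toFun := fun φ => ⟨_, (hMc φ).comp (continuous_const.add continuous_subtype_val)⟩
      map_add' := by
        intro φ ψ
        ext1 s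
        by_cases h : 1 + (s : ℝ) ≤ 0 <;> simp [h, IccExtend, y]
      map_smul' := by
        intro c φ
        ext1 s
        by_cases h : 1 + (s : ℝ) ≤ 0 <;> simp [h, IccExtend, y] }, fun _ _ => rfl⟩
  have hMb : ∀ φ, ‖M₀ φ‖ ≤ (1 + ‖S‖ * (1 + K)) * ‖φ‖ := by
    intro φ
    rw [ContinuousMap.norm_le _ (by positivity)]
    intro s
    rw [hM₀, add_mul, one_mul]
    have h1 : 0 ≤ ‖φ‖ := norm_nonneg _
    have h2 : 0 ≤ ‖S‖ * (1 + K) * ‖φ‖ := by positivity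
    split_ifs
    · exact (φ.norm_coe_le_norm _).trans (by linarith)
    · refine ((y φ).norm_coe_le_norm _).trans ?_
      have := (S.le_opNorm (G₀ φ)).trans (mul_le_mul_of_nonneg_left (hGb φ) (norm_nonneg S))
      rw [← mul_assoc] at this
      exact this.trans (by linarith)
  refine ⟨M₀.mkContinuous _ hMb, fun φ =>
    ⟨fun t => if t ≤ 0 then IccExtend hr0 φ t else IccExtend zero_le_one (y φ) t,
      ⟨(hMc φ).continuousOn, ?_, ?_⟩, fun s => hM₀ φ s⟩⟩
  · intro s
    simp [s.2.2]
  · intro t ht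
    have hd : HasDerivAt (fun t : ℝ => φ z + (∫ s in (0 : ℝ)..t, FB s (IccExtend hr0 φ (s - r)))
        + ∫ s in (0 : ℝ)..t, FA s (IccExtend zero_le_one (y φ) s))
        (FB t (IccExtend hr0 φ (t - r)) + FA t (IccExtend zero_le_one (y φ) t)) t :=
      (((hcont φ).integral_hasStrictDerivAt 0 t).hasDerivAt.const_add _).add
        ((hcont' (y φ)).integral_hasStrictDerivAt 0 t).hasDerivAt
    have heq : ∀ t ∈ Icc (0 : ℝ) 1,
        (if t ≤ 0 then IccExtend hr0 φ t else IccExtend zero_le_one (y φ) t) =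
        IccExtend zero_le_one (y φ) t := by
      intro t ht
      split_ifs with h
      · obtain rfl : t = 0 := le_antisymm h ht.1
        rw [IccExtend_of_mem hr0 _ (x := 0) ⟨hr0, le_rfl⟩,
          IccExtend_of_mem zero_le_one _ (x := 0) ⟨le_rfl, zero_le_one⟩]
        exact (hy0 φ).symm
      · rfl
    have htr : t - r ≤ 0 := by linarith [ht.2]
    simp only [htr, if_true, heq t ht]
    rw [← hFA', ← hFB', add_comm]
    refine hd.hasDerivWithinAt.congr_of_mem (fun u hu => ?_) ht
    rw [heq u hu, IccExtend_of_mem zero_le_one _ hu, ← hG₀ φ ⟨u, hu⟩]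
    exact hS (G₀ φ) ⟨u, hu⟩

open Classical in
/-- The time-`1` map on `C([-r, 0]; ℂⁿ)`. It exists by `exists_isTimeOneMap`. -/
def timeOneMap {n : ℕ} (A B : ℝ → Matrix (Fin n) (Fin n) ℝ) (r : ℝ) :
    C(Icc (-r) 0, Fin n → ℂ) →L[ℂ] C(Icc (-r) 0, Fin n → ℂ) :=
  if h : ∃ M, IsTimeOneMap A B r M then h.choose else 0

theorem isTimeOneMap_timeOneMap {n : ℕ} {A B : ℝ → Matrix (Fin n) (Fin n) ℝ} (hA : Continuous A)
    (hB : Continuous B) {r : ℝ} (hr : 1 ≤ r) : IsTimeOneMap A B r (timeOneMap A B r) := by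
  have h := exists_isTimeOneMap hA hB hr
  rw [timeOneMap, dif_pos h]
  exact h.choose_spec

/-- The Floquet exponents of `M`: all complex `μ` for which `exp μ` is an eigenvalue of `M`. -/
def floquetExponents {X : Type*} [NormedAddCommGroup X] [NormedSpace ℂ X] (M : X →L[ℂ] X) :
    Set ℂ :=
  {μ | Module.End.HasEigenvalue (M : X →ₗ[ℂ] X) (Complex.exp μ)}

/-- The generalized eigenspace `⋃ₖ ker (M - exp μ)ᵏ`; its dimension is the algebraic multiplicity
of the Floquet exponent `μ`. -/
def floquetSpace {X : Type*} [NormedAddCommGroup X] [NormedSpace ℂ X] (M : X →L[ℂ] X)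
    (μ : ℂ) : Submodule ℂ X :=
  Module.End.maxGenEigenspace (M : X →ₗ[ℂ] X) (Complex.exp μ)

/-! ### The characteristic function -/

/-- `U` is the propagation matrix from time `s` to time `t` of `y' = [A - μ I] y`: every `U v` is
the value at `t` of a solution on `[s, t]` that equals `v` at `s`. -/
def IsPropagator {n : ℕ} (A : ℝ → Matrix (Fin n) (Fin n) ℝ) (t s : ℝ) (μ : ℂ)
    (U : Matrix (Fin n) (Fin n) ℂ) : Prop :=
  ∀ v : Fin n → ℂ, ∃ y : ℝ → Fin n → ℂ, y s = v ∧ y t = U *ᵥ v ∧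
    ∀ r ∈ Icc s t, HasDerivWithinAt y ((toComplex (A r) - μ • 1) *ᵥ y r) (Icc s t) r

theorem exists_isPropagator {n : ℕ} {A : ℝ → Matrix (Fin n) (Fin n) ℝ} (hA : Continuous A)
    {s t : ℝ} (hst : s ≤ t) (μ : ℂ) : ∃ U, IsPropagator A t s μ U := by
  obtain ⟨F, hF, hF'⟩ := exists_clm ((continuous_toComplex hA).sub continuous_const :
    Continuous fun r => toComplex (A r) - μ • (1 : Matrix (Fin n) (Fin n) ℂ))
  obtain ⟨S, hS⟩ := exists_volterra hst F hF
  have hcont : ∀ y : C(Icc s t, Fin n → ℂ), Continuous fun r : ℝ => F r (IccExtend hst y r) :=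
    fun y => hF.clm_apply (y.continuous.Icc_extend' (h := hst))
  let L : (Fin n → ℂ) →ₗ[ℂ] (Fin n → ℂ) :=
    { toFun := fun v => S (ContinuousMap.const _ v) ⟨t, hst, le_rfl⟩
      map_add' := fun v w => by
        have : ContinuousMap.const (Icc s t) (v + w) =
          ContinuousMap.const _ v + ContinuousMap.const _ w := rfl
        rw [this, map_add, ContinuousMap.add_apply]
      map_smul' := fun c v => by
        have : ContinuousMap.const (Icc s t) (c • v) = c • ContinuousMap.const _ v := rfl
        rw [this, map_smul, ContinuousMap.smul_apply, RingHom.id_apply] }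
  refine ⟨LinearMap.toMatrix' L, fun v => ?_⟩
  set g : C(Icc s t, Fin n → ℂ) := ContinuousMap.const _ v
  have hd : ∀ r, HasDerivAt (fun r : ℝ => v + ∫ q in s..r, F q (IccExtend hst (S g) q))
      (F r (IccExtend hst (S g) r)) r := fun r =>
    ((hcont (S g)).integral_hasStrictDerivAt s r).hasDerivAt.const_add _
  have heq : ∀ r (hr : r ∈ Icc s t), v + ∫ q in s..r, F q (IccExtend hst (S g) q) =
      S g ⟨r, hr⟩ := fun r hr => (hS g ⟨r, hr⟩).symm
  refine ⟨fun r => v + ∫ q in s..r, F q (IccExtend hst (S g) q), by simp, ?_, fun r hr => ?_⟩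
  · rw [LinearMap.toMatrix'_mulVec]
    exact heq t ⟨hst, le_rfl⟩
  · have h := (hd r).hasDerivWithinAt (s := Icc s t)
    rw [hF', IccExtend_of_mem hst _ hr, ← heq r hr] at h
    exact h

open Classical in
/-- The propagation matrix `U(t, s, μ)` for `s ≤ t`. It exists by `exists_isPropagator`. -/
def propagator {n : ℕ} (A : ℝ → Matrix (Fin n) (Fin n) ℝ) (t s : ℝ) (μ : ℂ) :
    Matrix (Fin n) (Fin n) ℂ :=
  if h : ∃ U, IsPropagator A t s μ U then h.choose else 0

theorem isPropagator_propagator {n : ℕ} {A : ℝ → Matrix (Fin n) (Fin n) ℝ} (hA : Continuous A)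
    {s t : ℝ} (hst : s ≤ t) (μ : ℂ) : IsPropagator A t s μ (propagator A t s μ) := by
  have h := exists_isPropagator hA hst μ
  rw [propagator, dif_pos h]
  exact h.choose_spec

/-- The representative of `t` modulo `1` in `[-1, 0)`. -/
def perMod (t : ℝ) : ℝ := Int.fract t - 1

/-- The partition point `t_j = -1 + j / k`. -/
def node (k j : ℕ) : ℝ := -1 + (j : ℝ) / k

/-- The subinterval `I_j = [t_j, t_{j+1})` of `[-1, 0]`, where the last one also contains `0`. -/
def cell (k j : ℕ) : Set ℝ :=
  if j + 1 = k then Icc (node k j) 0 else Ico (node k j) (node k (j + 1))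

/-- `y`, restricted to `[-1, 0]`, belongs to the space `C_k` of functions that are continuous on
each subinterval and have left limits at the partition points. -/
def IsPiecewiseContinuous {n : ℕ} (k : ℕ) (y : ℝ → Fin n → ℂ) : Prop :=
  ∀ j < k, ContinuousOn y (cell k j) ∧ ∃ l, Tendsto y (𝓝[<] (node k (j + 1))) (𝓝 l)

/-- `y ∈ C_k` solves the integral equation of the multiple initial value problem
`y'(t) = [A(t) - μ I] y(t) + z B(t) y((t - τ) mod [-1, 0])`, `y(t_j) = v_j`. -/
structure IsMIVPSolution {n : ℕ} (A B : ℝ → Matrix (Fin n) (Fin n) ℝ) (τ : ℝ) (k : ℕ) (μ z : ℂ)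
    (v : Fin k → Fin n → ℂ) (y : ℝ → Fin n → ℂ) : Prop where
  piecewise : IsPiecewiseContinuous k y
  eqn : ∀ j : Fin k, ∀ t ∈ cell k j, y t = propagator A t (node k j) μ *ᵥ v j +
    z • ∫ s in (node k j)..t, propagator A t s μ *ᵥ (toComplex (B s) *ᵥ y (perMod (s - τ)))

open Classical in
/-- The solution `y = [I - z L_k(μ)]⁻¹ S(μ) v` of the integral equation. On `[-1, 0]` it exists and
is unique if `Re μ ≥ -R`, `|z| ≤ exp R` and `k > partitionBound A B R`; only these parameters and
the values on `[-1, 0]` matter. -/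
def mivpSolution {n : ℕ} (A B : ℝ → Matrix (Fin n) (Fin n) ℝ) (τ : ℝ) (k : ℕ) (μ z : ℂ)
    (v : Fin k → Fin n → ℂ) : ℝ → Fin n → ℂ :=
  if h : ∃ y, IsMIVPSolution A B τ k μ z v y then h.choose else 0

/-- The linear map `v ↦ Δ(μ, z) v`, with blocks `v_0 - y(0)` and `v_j - y(t_j-)` for `j ≥ 1`. -/
def charMap {n : ℕ} (A B : ℝ → Matrix (Fin n) (Fin n) ℝ) (τ : ℝ) (k : ℕ) (μ z : ℂ)
    (v : Fin k → Fin n → ℂ) : Fin k → Fin n → ℂ := fun j =>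
  v j - if (j : ℕ) = 0 then mivpSolution A B τ k μ z v 0
    else Function.leftLim (mivpSolution A B τ k μ z v) (node k j)

/-- The characteristic matrix `Δ(μ, z)`; its column `q` is the image of the unit vector `q`. -/
def charMatrix {n : ℕ} (A B : ℝ → Matrix (Fin n) (Fin n) ℝ) (τ : ℝ) (k : ℕ) (μ z : ℂ) :
    Matrix (Fin k × Fin n) (Fin k × Fin n) ℂ :=
  Matrix.of fun p q => charMap A B τ k μ z (Pi.single q.1 (Pi.single q.2 1)) p.1 p.2

/-- The characteristic function `h(μ, z) = det Δ(μ, z)`. -/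
def charFun {n : ℕ} (A B : ℝ → Matrix (Fin n) (Fin n) ℝ) (τ : ℝ) (k : ℕ) (μ z : ℂ) : ℂ :=
  (charMatrix A B τ k μ z).det

section

attribute [local instance] Matrix.linftyOpNormedAddCommGroup

/-- `‖A‖_∞ = max_{-1 ≤ t ≤ 0} ‖A(t)‖_∞`, with the matrix norm induced by the maximum norm. -/
def maxNorm {n : ℕ} (A : ℝ → Matrix (Fin n) (Fin n) ℝ) : ℝ :=
  sSup ((fun t => ‖A t‖) '' Icc (-1 : ℝ) 0)

end

/-- `C(R) = max {‖A‖_∞ + R, ‖B‖_∞ exp (1 + R)}`. -/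
def partitionBound {n : ℕ} (A B : ℝ → Matrix (Fin n) (Fin n) ℝ) (R : ℝ) : ℝ :=
  max (maxNorm A + R) (maxNorm B * Real.exp (1 + R))

end DelayFloquet

end

noncomputable section

namespace DelayFloquet

/-! With `g = Re μ₀ / 2`, conjugate the time-one map by the weight `exp (-g s)`. The pure shift part
of the map then has norm at most `exp g`, which is less than `|exp μ₀|`, while the delay term only
reads the history on `[-r, 1 - r]`, where it is damped by `exp (g (1 - r))`. As the delay `r = τ +
N` grows, the conjugated map `T` therefore approaches, in operator norm, the conjugated map `T₀` of
`x' = A x` (`exists_weighted_timeOneMap`). Evaluation at `0` makes `T₀` block triangular: one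
diagonal block is the monodromy operator `Φ` on `ℂⁿ`, the other, on functions vanishing at `0`, has
norm at most `exp g`. Near `a = exp μ₀` only `Φ` matters.

The function space changes with `N`, so the perturbation argument needs constants independent of the
space. `exists_fredholmData` gives, with uniform bounds, a generalized inverse of `Q₀ = (T₀ - a)^d`,
where `d` is so large that `V = ker (Φ - a)^d` is the generalized eigenspace of `Φ`. If `a` is not
an eigenvalue, `d = 1` suffices and a Neumann series puts `a` in the resolvent set of `T`.

Otherwise multiplicities are counted through decay rates rather than contour integrals. Let `Q = (T
- a)^d`. By a Lyapunov-Perron contraction (`bijective_decaySubspace`), the vectors with `‖Q^j x‖ ≤ c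
r^j` form a space isomorphic to `V` for every rate `r` in a whole range. So the spaces for `ρ₁^d`
and `ρ₀^d` coincide. The larger rate captures all generalized eigenvectors with eigenvalue within
`ρ₀` of `a`, the smaller one forces eigenvalues of `T` on this space into the closed disc of radius
`ρ₁`; hence the total multiplicity is `dim V` (`finsum_finrank_of_decaySubspace`).

Finally `h(μ, 0) = det (1 - exp (-μ) Φ)` (`charFun_zero`), so its order of vanishing at `μ₀` is `dim
V`, because `exp` is locally biholomorphic. -/

/-! ### Orbits decaying at a prescribed rate: the Lyapunov-Perron method. -/

/-- The vectors whose orbit under `Q` is bounded by a multiple of `r ^ j`. -/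
def decaySubspace {X : Type*} [NormedAddCommGroup X] [NormedSpace ℂ X] (Q : X →L[ℂ] X) (r : ℝ) :
    Submodule ℂ X where
  carrier := {x | ∃ c, ∀ j : ℕ, ‖(Q ^ j) x‖ ≤ c * r ^ j}
  add_mem' := by
    rintro x y ⟨c, hc⟩ ⟨d, hd⟩
    refine ⟨c + d, fun j => ?_⟩
    rw [map_add, add_mul]
    exact (norm_add_le _ _).trans (add_le_add (hc j) (hd j))
  zero_mem' := ⟨0, fun j => by simp⟩
  smul_mem' := by
    rintro a x ⟨c, hc⟩
    refine ⟨‖a‖ * c, fun j => ?_⟩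
    rw [map_smul, norm_smul, mul_assoc]
    exact mul_le_mul_of_nonneg_left (hc j) (norm_nonneg _)

/-- The Lyapunov-Perron operator on bounded sequences: its fixed points, up to the inhomogeneity
`J v` at `0`, are the rescaled orbits of `Q₀ + W`. -/
theorem exists_lyapunovPerron {X V : Type*} [NormedAddCommGroup X] [NormedSpace ℂ X]
    [NormedAddCommGroup V] [NormedSpace ℂ V] (W L : X →L[ℂ] X) (J : V →L[ℂ] X) (e : X →L[ℂ] V)
    {r : ℝ} (hr : 0 < r) :
    ∃ K : (BoundedContinuousFunction ℕ X) →L[ℂ] (BoundedContinuousFunction ℕ X),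
      (∀ y, K y 0 = L (r • y 1 - W (y 0))) ∧
      (∀ y j, K y (j + 1) =
        r⁻¹ • J (e (W (y j))) + L (r • y (j + 2) - W (y (j + 1)))) ∧
      ‖K‖ ≤ ‖L‖ * (r + ‖W‖) + r⁻¹ * (‖J‖ * ‖e‖ * ‖W‖) := by
  set c := ‖L‖ * (r + ‖W‖) + r⁻¹ * (‖J‖ * ‖e‖ * ‖W‖) with hc
  have hr' : 0 ≤ r⁻¹ := (inv_pos.2 hr).le
  have hc0 : 0 ≤ c := by positivity
  -- The `J` term is absent at index `0` because `e (y 0)` is the free parameter of the orbit; at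
  -- later indices it is determined by the previous term.
  let p : BoundedContinuousFunction ℕ X → ℕ → X := fun y j =>
    Nat.casesOn j 0 fun i => r⁻¹ • J (e (W (y i)))
  let k : BoundedContinuousFunction ℕ X → ℕ → X := fun y j =>
    p y j + L (r • y (j + 1) - W (y j))
  have hp : ∀ y j, ‖p y j‖ ≤ r⁻¹ * (‖J‖ * ‖e‖ * ‖W‖) * ‖y‖ := by
    intro y j
    cases j with
    | zero => exact (norm_zero (E := X)).trans_le (by positivity)
    | succ i =>
      simp only [p]
      rw [norm_smul, Real.norm_of_nonneg hr', mul_assoc]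
      refine mul_le_mul_of_nonneg_left ?_ hr'
      calc ‖J (e (W (y i)))‖ ≤ ‖J‖ * (‖e‖ * (‖W‖ * ‖y i‖)) :=
            J.le_opNorm_of_le (e.le_opNorm_of_le (W.le_opNorm _))
        _ ≤ ‖J‖ * (‖e‖ * (‖W‖ * ‖y‖)) := by gcongr; exact y.norm_coe_le_norm i
        _ = _ := by ring
  have hk : ∀ y j, ‖k y j‖ ≤ c * ‖y‖ := by
    intro y j
    have h1 : ‖L (r • y (j + 1) - W (y j))‖ ≤ ‖L‖ * (r + ‖W‖) * ‖y‖ := by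
      rw [mul_assoc]
      refine L.le_opNorm_of_le ((norm_sub_le _ _).trans ?_)
      rw [norm_smul, Real.norm_of_nonneg hr.le, add_mul]
      exact add_le_add (mul_le_mul_of_nonneg_left (y.norm_coe_le_norm _) hr.le)
        (W.le_opNorm_of_le (y.norm_coe_le_norm _))
    refine (norm_add_le _ _).trans ?_
    rw [hc, add_mul, add_comm]
    exact add_le_add h1 (hp y j)
  have hpa : ∀ x y j, p (x + y) j = p x j + p y j := by
    intro x y j
    cases j with
    | zero => exact (add_zero _).symm
    | succ i => simp [p]
  have hps : ∀ (a : ℂ) y j, p (a • y) j = a • p y j := by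
    intro a y j
    cases j with
    | zero => exact (smul_zero _).symm
    | succ i => simp [p, smul_comm r⁻¹ a]
  let K₀ : (BoundedContinuousFunction ℕ X) →ₗ[ℂ] (BoundedContinuousFunction ℕ X) :=
    { toFun := fun y => BoundedContinuousFunction.ofNormedAddCommGroupDiscrete (k y) _ (hk y)
      map_add' := by
        intro x y
        ext j
        simp only [k, hpa, BoundedContinuousFunction.coe_ofNormedAddCommGroupDiscrete,
          BoundedContinuousFunction.coe_add, Pi.add_apply, map_add, map_sub, smul_add]
        abel
      map_smul' := by
        intro a y
        ext j
        simp only [k, hps, BoundedContinuousFunction.coe_ofNormedAddCommGroupDiscrete,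
          BoundedContinuousFunction.coe_smul, map_smul, RingHom.id_apply, smul_add,
          smul_comm r a, ← smul_sub] }
  have hK₀ : ∀ y, ‖K₀ y‖ ≤ c * ‖y‖ := fun y =>
    (BoundedContinuousFunction.norm_le (by positivity)).2 (hk y)
  refine ⟨K₀.mkContinuous c hK₀, fun y => ?_, fun y j => rfl,
    LinearMap.mkContinuous_norm_le _ hc0 _⟩
  change (0 : X) + _ = _
  rw [zero_add]

/-- A perturbation `Q = Q₀ + W` of an operator with Fredholm inverse data `J`, `e`, `L` has
exactly one orbit decaying at rate `r` for every element of the kernel of `Q₀`. -/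
theorem bijective_decaySubspace {X V : Type*} [NormedAddCommGroup X] [NormedSpace ℂ X]
    [CompleteSpace X] [NormedAddCommGroup V] [NormedSpace ℂ V]
    {Q Q₀ L : X →L[ℂ] X} {J : V →L[ℂ] X} {e : X →L[ℂ] V} {r : ℝ} (hr : 0 < r)
    (heJ : ∀ v, e (J v) = v) (heL : ∀ x, e (L x) = 0) (heQ : ∀ x, e (Q₀ x) = 0)
    (hQJ : ∀ v, Q₀ (J v) = 0) (hQL : ∀ x, e x = 0 → Q₀ (L x) = x)
    (hLQ : ∀ x, L (Q₀ x) = x - J (e x))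
    (hsmall : ‖L‖ * (r + ‖Q - Q₀‖) + r⁻¹ * (‖J‖ * ‖e‖ * ‖Q - Q₀‖) < 1) :
    Function.Bijective (e.toLinearMap.domRestrict (decaySubspace Q r)) := by
  obtain ⟨K, hK0, hK1, hK⟩ := exists_lyapunovPerron (Q - Q₀) L J e hr
  have hK' : ‖K‖ < 1 := hK.trans_lt hsmall
  have hr0 : r ≠ 0 := hr.ne'
  constructor
  · rw [← LinearMap.ker_eq_bot, LinearMap.ker_eq_bot']
    rintro ⟨x, c, hc⟩ hx
    have hx : e x = 0 := hx
    -- Rescaling by `r⁻ʲ` turns an orbit decaying at rate `r` into a bounded sequence with `r y (j +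
    -- 1) = Q (y j)`. If `e x = 0`, it is a fixed point of the contraction `K`, hence zero.
    have hb : ∀ j : ℕ, ‖(r⁻¹ ^ j) • (Q ^ j) x‖ ≤ c := by
      intro j
      rw [norm_smul, norm_pow, Real.norm_of_nonneg (inv_pos.2 hr).le, inv_pow,
        inv_mul_le_iff₀ (pow_pos hr j), mul_comm]
      exact hc j
    let y := BoundedContinuousFunction.ofNormedAddCommGroupDiscrete _ c hb
    have hy : ∀ j, y j = (r⁻¹ ^ j) • (Q ^ j) x := fun j => rfl
    have hys : ∀ j, r • y (j + 1) = Q (y j) := by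
      intro j
      rw [hy, hy, pow_succ r⁻¹, pow_succ' Q, smul_smul, mul_comm (r⁻¹ ^ j), ← mul_assoc,
        mul_inv_cancel₀ hr0, one_mul, mul_apply_eq_comp, ContinuousLinearMap.map_smul_of_tower]
    have hL : ∀ j, L (r • y (j + 1) - (Q - Q₀) (y j)) = y j - J (e (y j)) := by
      intro j
      rw [hys, ← hLQ, sub_apply, sub_sub_cancel]
    have hKy : K y = y := by
      ext j
      cases j with
      | zero =>
        rw [hK0, hL, hy 0]
        simp [hx]
      | succ j =>
        rw [hK1, hL (j + 1)]
        have : e ((Q - Q₀) (y j)) = e (Q (y j)) := by rw [sub_apply, map_sub, heQ, sub_zero]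
        rw [this, ← hys]
        rw [ContinuousLinearMap.map_smul_of_tower, ContinuousLinearMap.map_smul_of_tower,
          smul_smul, inv_mul_cancel₀ hr0, one_smul]
        abel
    have hy0 : y = 0 := by
      by_contra hne
      have h1 : ‖y‖ ≤ ‖K‖ * ‖y‖ := by
        conv_lhs => rw [← hKy]
        exact K.le_opNorm y
      have h2 : 0 < ‖y‖ := norm_pos_iff.2 hne
      nlinarith
    have := hy 0
    rw [hy0] at this
    exact Subtype.ext (by simpa [eq_comm] using this)
  · intro v
    obtain ⟨u, hu⟩ := isUnit_one_sub_of_norm_lt_one hK'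
    have hJv : ∀ j : ℕ, ‖(if j = 0 then J v else 0 : X)‖ ≤ ‖J v‖ := by
      intro j
      split_ifs <;> simp
    let b := BoundedContinuousFunction.ofNormedAddCommGroupDiscrete _ _ hJv
    obtain ⟨y, hy⟩ : ∃ y, y = b + K y := by
      refine ⟨(↑u⁻¹ : (BoundedContinuousFunction ℕ X) →L[ℂ] _) b, ?_⟩
      have h1 : ((1 : (BoundedContinuousFunction ℕ X) →L[ℂ] BoundedContinuousFunction ℕ X) - K) ((↑u⁻¹ :
          (BoundedContinuousFunction ℕ X) →L[ℂ] (BoundedContinuousFunction ℕ X)) b) = b := by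
        rw [← hu, ← mul_apply_eq_comp, u.mul_inv]
        rfl
      rw [sub_apply, sub_eq_iff_eq_add] at h1
      exact h1
    have hy0 : y 0 = J v + L (r • y 1 - (Q - Q₀) (y 0)) := by
      have := congrArg (fun z : BoundedContinuousFunction ℕ X => z 0) hy
      simp only [BoundedContinuousFunction.coe_add, Pi.add_apply, hK0] at this
      simpa [b] using this
    have hy1 : ∀ j, y (j + 1) = r⁻¹ • J (e ((Q - Q₀) (y j))) +
        L (r • y (j + 2) - (Q - Q₀) (y (j + 1))) := by
      intro j
      have := congrArg (fun z : BoundedContinuousFunction ℕ X => z (j + 1)) hy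
      simp only [BoundedContinuousFunction.coe_add, Pi.add_apply, hK1] at this
      simpa [b] using this
    -- This is the solvability condition for `Q₀ (y j) = r y (j + 1) - (Q - Q₀) (y j)`; the `J` term
    -- of `K` was designed to enforce it.
    have hey : ∀ j, e (r • y (j + 1) - (Q - Q₀) (y j)) = 0 := by
      intro j
      rw [map_sub, ContinuousLinearMap.map_smul_of_tower, hy1, map_add, heL, add_zero,
        ContinuousLinearMap.map_smul_of_tower, heJ, smul_smul, mul_inv_cancel₀ hr0, one_smul,
        sub_self]
    have hstep : ∀ j, Q (y j) = r • y (j + 1) := by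
      intro j
      have h1 : Q₀ (y j) = r • y (j + 1) - (Q - Q₀) (y j) := by
        cases j with
        | zero =>
          conv_lhs => rw [hy0]
          rw [map_add, hQJ, zero_add, hQL _ (hey 0)]
        | succ j =>
          conv_lhs => rw [hy1]
          rw [map_add, ContinuousLinearMap.map_smul_of_tower, hQJ, smul_zero, zero_add,
            hQL _ (hey (j + 1))]
      rw [sub_apply, ← sub_add, eq_comm, add_eq_right, sub_eq_zero] at h1
      exact h1.symm
    have horb : ∀ j, (Q ^ j) (y 0) = r ^ j • y j := by
      intro j
      induction j with
      | zero => simp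
      | succ j ih =>
        rw [pow_succ', mul_apply_eq_comp, ih, ContinuousLinearMap.map_smul_of_tower, hstep,
          smul_smul, pow_succ]
    refine ⟨⟨y 0, ‖y‖, fun j => ?_⟩, ?_⟩
    · rw [horb, norm_smul, norm_pow, Real.norm_of_nonneg hr.le, mul_comm]
      exact mul_le_mul_of_nonneg_right (y.norm_coe_le_norm j) (by positivity)
    · change e (y 0) = v
      rw [hy0, map_add, heJ, heL, add_zero]

/-! ### Counting eigenvalues through decay subspaces. -/

theorem finsum_finrank_maxGenEigenspace {K V : Type*} [Field K] [IsAlgClosed K] [AddCommGroup V]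
    [Module K V] [FiniteDimensional K V] (f : Module.End K V) :
    {μ | f.HasEigenvalue μ}.Finite ∧
      ∑ᶠ μ ∈ {μ | f.HasEigenvalue μ}, Module.finrank K (f.maxGenEigenspace μ) =
        Module.finrank K V := by
  classical
  have hset : {μ | f.HasEigenvalue μ} = (f.charpoly.roots.toFinset : Set K) := by
    ext μ
    simp [Module.End.hasEigenvalue_iff_isRoot_charpoly, f.charpoly_monic.ne_zero]
  refine ⟨hset ▸ Finset.finite_toSet _, ?_⟩
  rw [hset, finsum_mem_coe_finset]
  simp_rw [LinearMap.finrank_maxGenEigenspace_eq, ← Polynomial.count_roots]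
  rw [Multiset.toFinset_sum_count_eq, IsAlgClosed.card_roots_eq_natDegree,
    LinearMap.charpoly_natDegree]

/-- Orbits of generalized eigenvectors grow at most like any `ρ ^ j` with `ρ` larger than the
modulus of the eigenvalue. -/
theorem exists_norm_pow_apply_le_of_mem_maxGenEigenspace {X : Type*} [NormedAddCommGroup X]
    [NormedSpace ℂ X] (T : X →L[ℂ] X) {a lam : ℂ} {ρ : ℝ} (h : ‖lam - a‖ < ρ) {x : X}
    (hx : x ∈ Module.End.maxGenEigenspace (T : X →ₗ[ℂ] X) lam) :
    ∃ c, ∀ j : ℕ, ‖((T - a • 1) ^ j) x‖ ≤ c * ρ ^ j := by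
  have hρ : 0 < ρ := (norm_nonneg _).trans_lt h
  obtain ⟨k, hk⟩ := (Module.End.mem_maxGenEigenspace _ _ _).1 hx
  clear hx
  induction k generalizing x with
  | zero =>
    have hx : x = 0 := by simpa using hk
    exact ⟨0, fun j => by rw [hx, map_zero, norm_zero, zero_mul]⟩
  | succ k ih =>
    rw [pow_succ, Module.End.mul_apply] at hk
    obtain ⟨c, hc⟩ := ih hk
    set w : X := ((T : X →ₗ[ℂ] X) - lam • (1 : Module.End ℂ X)) x with hw
    have hw' : (T - a • (1 : X →L[ℂ] X)) x = (lam - a) • x + w := by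
      simp [hw, sub_smul]
    have hstep : ∀ j, ((T - a • (1 : X →L[ℂ] X)) ^ (j + 1)) x =
        (lam - a) • ((T - a • (1 : X →L[ℂ] X)) ^ j) x + ((T - a • (1 : X →L[ℂ] X)) ^ j) w := by
      intro j
      rw [pow_succ, mul_apply_eq_comp, hw', map_add, map_smul]
    have hgap : 0 < ρ - ‖lam - a‖ := sub_pos.2 h
    refine ⟨max ‖x‖ (c / (ρ - ‖lam - a‖)), fun j => ?_⟩
    set C := max ‖x‖ (c / (ρ - ‖lam - a‖))
    -- With this choice the recursion closes: `|lam - a| C + c ≤ C ρ`.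
    have hC : c ≤ C * (ρ - ‖lam - a‖) := (div_le_iff₀ hgap).1 (le_max_right _ _)
    induction j with
    | zero =>
      rw [pow_zero, pow_zero, mul_one]
      exact le_max_left _ _
    | succ j ihj =>
      rw [hstep]
      calc _ ≤ ‖lam - a‖ * (C * ρ ^ j) + c * ρ ^ j := by
            refine (norm_add_le _ _).trans (add_le_add ?_ (hc j))
            rw [norm_smul]
            gcongr
        _ ≤ ‖lam - a‖ * (C * ρ ^ j) + C * (ρ - ‖lam - a‖) * ρ ^ j := by gcongr
        _ = C * ρ ^ (j + 1) := by ring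

theorem maxGenEigenspace_le_decaySubspace {X : Type*} [NormedAddCommGroup X]
    [NormedSpace ℂ X] (T : X →L[ℂ] X) {a lam : ℂ} {ρ : ℝ} (h : ‖lam - a‖ < ρ) (d : ℕ) :
    Module.End.maxGenEigenspace (T : X →ₗ[ℂ] X) lam ≤ decaySubspace ((T - a • 1) ^ d) (ρ ^ d) := by
  intro x hx
  obtain ⟨c, hc⟩ := exists_norm_pow_apply_le_of_mem_maxGenEigenspace T h hx
  refine ⟨c, fun j => ?_⟩
  rw [← pow_mul, ← pow_mul]
  exact hc _

theorem decaySubspace_invariant {X : Type*} [NormedAddCommGroup X] [NormedSpace ℂ X]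
    {T Q : X →L[ℂ] X} (hTQ : Commute T Q) (r : ℝ) : ∀ x ∈ decaySubspace Q r,
      (T : X →ₗ[ℂ] X) x ∈ decaySubspace Q r := by
  rintro x ⟨c, hc⟩
  refine ⟨‖T‖ * c, fun j => ?_⟩
  have h : (Q ^ j) (T x) = T ((Q ^ j) x) := by
    rw [← mul_apply_eq_comp, ← mul_apply_eq_comp, (hTQ.pow_right j).eq]
  rw [ContinuousLinearMap.coe_coe, h, mul_assoc]
  exact T.le_opNorm_of_le (hc j)

/-- The orbit of an eigenvector under `(T - a)^d` is exactly geometric with ratio `(lam - a)^d`, so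
its decay rate bounds `|lam - a|`. -/
theorem norm_sub_le_of_eigenvector_mem_decaySubspace {X : Type*} [NormedAddCommGroup X]
    [NormedSpace ℂ X] {T : X →L[ℂ] X} {a lam : ℂ} {ρ : ℝ} (hρ : 0 < ρ) {d : ℕ} (hd : d ≠ 0)
    {x : X} (hx : x ∈ decaySubspace ((T - a • 1) ^ d) (ρ ^ d)) (hx0 : x ≠ 0)
    (hTx : T x = lam • x) : ‖lam - a‖ ≤ ρ := by
  obtain ⟨c, hc⟩ := hx
  have h1 : ∀ j : ℕ, ((T - a • (1 : X →L[ℂ] X)) ^ j) x = (lam - a) ^ j • x := by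
    intro j
    induction j with
    | zero => simp
    | succ j ih =>
      rw [pow_succ, mul_apply_eq_comp]
      have : (T - a • (1 : X →L[ℂ] X)) x = (lam - a) • x := by simp [hTx, sub_smul]
      rw [this, map_smul, ih, smul_smul, pow_succ']
  by_contra! hlt
  set q := (‖lam - a‖ / ρ) ^ d with hq
  have hq1 : 1 < q := one_lt_pow₀ ((one_lt_div hρ).2 hlt) hd
  have hb : ∀ j : ℕ, q ^ j ≤ c / ‖x‖ := by
    intro j
    have h2 := hc j
    rw [← pow_mul, h1, norm_smul, norm_pow, ← pow_mul] at h2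
    rw [hq, ← pow_mul, div_pow, le_div_iff₀ (norm_pos_iff.2 hx0), div_mul_eq_mul_div,
      div_le_iff₀ (by positivity)]
    exact h2
  obtain ⟨j, hj⟩ := ((tendsto_pow_atTop_atTop_of_one_lt hq1).eventually_gt_atTop (c / ‖x‖)).exists
  exact absurd (hb j) (not_le.2 hj)

/-- If the subspaces of decay rates `ρ₁ < ρ₀` have the same finite dimension, then this is the
total multiplicity of the eigenvalues in any set between the two discs. -/
theorem finsum_finrank_of_decaySubspace {X : Type*} [NormedAddCommGroup X] [NormedSpace ℂ X]
    (T : X →L[ℂ] X) (a : ℂ) {d : ℕ} (hd : d ≠ 0) {ρ₁ ρ₀ : ℝ} (hρ₁ : 0 < ρ₁) (hρ : ρ₁ ≤ ρ₀)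
    {D : Set ℂ} (hD₁ : Metric.closedBall a ρ₁ ⊆ D) (hD₀ : D ⊆ Metric.ball a ρ₀)
    [FiniteDimensional ℂ (decaySubspace ((T - a • 1) ^ d) (ρ₀ ^ d))]
    (hdim : Module.finrank ℂ (decaySubspace ((T - a • 1) ^ d) (ρ₁ ^ d)) =
      Module.finrank ℂ (decaySubspace ((T - a • 1) ^ d) (ρ₀ ^ d))) :
    (D ∩ {lam | Module.End.HasEigenvalue (T : X →ₗ[ℂ] X) lam}).Finite ∧
    (∀ lam ∈ D, FiniteDimensional ℂ (Module.End.maxGenEigenspace (T : X →ₗ[ℂ] X) lam)) ∧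
    ∑ᶠ lam ∈ D ∩ {lam | Module.End.HasEigenvalue (T : X →ₗ[ℂ] X) lam},
      Module.finrank ℂ (Module.End.maxGenEigenspace (T : X →ₗ[ℂ] X) lam) =
      Module.finrank ℂ (decaySubspace ((T - a • 1) ^ d) (ρ₀ ^ d)) := by
  set Y := decaySubspace ((T - a • (1 : X →L[ℂ] X)) ^ d) (ρ₀ ^ d) with hY
  -- The space for the faster decay is contained in the other and has the same finite dimension.
  -- This excludes eigenvalues of `T` on `Y` outside the closed disc of radius `ρ₁`.
  have hYeq : decaySubspace ((T - a • (1 : X →L[ℂ] X)) ^ d) (ρ₁ ^ d) = Y := by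
    refine Submodule.eq_of_le_of_finrank_eq ?_ hdim
    rintro x ⟨c, hc⟩
    have hc0 : 0 ≤ c := (norm_nonneg _).trans (by simpa using hc 0)
    exact ⟨c, fun j => (hc j).trans (by gcongr)⟩
  have hinv := decaySubspace_invariant (((Commute.refl T).sub_right
    ((Commute.one_right T).smul_right a)).pow_right d) (ρ₀ ^ d)
  let f : Module.End ℂ Y := (T : X →ₗ[ℂ] X).restrict hinv
  have hle : ∀ lam ∈ D, Module.End.maxGenEigenspace (T : X →ₗ[ℂ] X) lam ≤ Y := fun lam hlam =>
    maxGenEigenspace_le_decaySubspace T (by simpa [dist_eq_norm] using hD₀ hlam) d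
  have hmap : ∀ lam ∈ D, Module.End.maxGenEigenspace (T : X →ₗ[ℂ] X) lam =
      (f.maxGenEigenspace lam).map Y.subtype := fun lam hlam => by
    rw [← inf_eq_right.2 (hle lam hlam)]
    exact Submodule.inf_genEigenspace _ _ hinv
  have hrank : ∀ lam ∈ D, Module.finrank ℂ (Module.End.maxGenEigenspace (T : X →ₗ[ℂ] X) lam) =
      Module.finrank ℂ (f.maxGenEigenspace lam) := fun lam hlam => by
    rw [hmap lam hlam]
    exact (Submodule.equivMapOfInjective _ Y.subtype_injective _).finrank_eq.symm
  have hset : D ∩ {lam | Module.End.HasEigenvalue (T : X →ₗ[ℂ] X) lam} =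
      {lam | f.HasEigenvalue lam} := by
    ext lam
    constructor
    · rintro ⟨hlam, hev⟩
      obtain ⟨x, hx, hx0⟩ := Module.End.HasEigenvalue.exists_hasEigenvector hev
      have hxY : x ∈ Y := hle lam hlam (Module.End.eigenspace_le_maxGenEigenspace hx)
      refine Module.End.hasEigenvalue_of_hasEigenvector (x := ⟨x, hxY⟩) ⟨?_, ?_⟩
      · rw [Module.End.mem_genEigenspace_one] at hx ⊢
        exact Subtype.ext hx
      · exact fun h => hx0 (congrArg Subtype.val h)
    · intro hev
      obtain ⟨⟨x, hxY⟩, hx, hx0⟩ := Module.End.HasEigenvalue.exists_hasEigenvector hev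
      have hx0' : x ≠ 0 := fun h => hx0 (Subtype.ext h)
      have hTx : T x = lam • x := by
        rw [Module.End.mem_genEigenspace_one] at hx
        exact congrArg Subtype.val hx
      refine ⟨hD₁ ?_, Module.End.hasEigenvalue_of_hasEigenvector (x := x)
        ⟨Module.End.mem_genEigenspace_one.2 hTx, hx0'⟩⟩
      rw [mem_closedBall_iff_norm]
      exact norm_sub_le_of_eigenvector_mem_decaySubspace hρ₁ hd (hYeq ▸ hxY) hx0' hTx
  obtain ⟨h1, h2⟩ := finsum_finrank_maxGenEigenspace f
  refine ⟨hset ▸ h1, fun lam hlam => ?_, ?_⟩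
  · exact Submodule.finiteDimensional_of_le (hle lam hlam)
  · rw [← h2, finsum_mem_congr rfl fun lam hlam => hrank lam hlam.1, hset]

/-! ### Uniform generalized inverses for block triangular operators. -/

/-- Let `p` be the projection onto the kernel along the range. Then `f + p` is invertible and agrees
with the identity on the kernel, so `N = (f + p)⁻¹ - p` inverts `f` on its range and vanishes on its
kernel. -/
theorem exists_pseudoInverse {V : Type*} [AddCommGroup V] [Module ℂ V] [FiniteDimensional ℂ V]
    (f : V →ₗ[ℂ] V) (hf : IsCompl f.ker f.range) :
    ∃ (N : V →ₗ[ℂ] V) (p : V →ₗ[ℂ] f.ker), (∀ v, f (N v) = v - p v) ∧ (∀ v, N (f v) = v - p v) ∧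
      (∀ v, p (N v) = 0) ∧ (∀ v : f.ker, p v = v) ∧ ∀ v, p (f v) = 0 := by
  obtain ⟨p, hp1, hp2⟩ : ∃ p : V →ₗ[ℂ] f.ker, (∀ v : f.ker, p v = v) ∧ ∀ v, p (f v) = 0 :=
    ⟨Submodule.projectionOnto _ _ hf, fun v => Submodule.projectionOnto_apply_left hf v, fun v =>
      (Submodule.projectionOnto_apply_eq_zero_iff hf).2 (LinearMap.mem_range_self f v)⟩
  have hfp : ∀ v, f (p v) = 0 := fun v => (p v).2
  let g : V →ₗ[ℂ] V := f + f.ker.subtype ∘ₗ p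
  have hg : ∀ v, g v = f v + p v := fun v => rfl
  have hpg : ∀ v, p (g v) = p v := fun v => by rw [hg, map_add, hp2, hp1, zero_add]
  have hinj : Function.Injective g := by
    rw [← LinearMap.ker_eq_bot, LinearMap.ker_eq_bot']
    intro v hv
    have h1 : p v = 0 := by rw [← hpg, hv, map_zero]
    rw [hg, h1, Submodule.coe_zero, add_zero] at hv
    have h2 := hp1 ⟨v, hv⟩
    rw [h1] at h2
    exact (congrArg Subtype.val h2).symm
  let G := LinearEquiv.ofInjectiveEndo g hinj
  have hG : ∀ v, g (G.symm v) = v := fun v => G.apply_symm_apply v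
  have hG' : ∀ v, G.symm (g v) = v := fun v => G.symm_apply_apply v
  have hpG : ∀ v, p (G.symm v) = p v := fun v => by rw [← hpg, hG]
  have hGp : ∀ v, G.symm (p v : V) = p v := fun v => by
    have : g (p v) = p v := by rw [hg, hfp, hp1, zero_add]
    rw [← this, hG', this]
  refine ⟨G.symm.toLinearMap - f.ker.subtype ∘ₗ p, p, fun v => ?_, fun v => ?_, fun v => ?_,
    hp1, hp2⟩
  · have := hG v
    rw [hg, hpG] at this
    simp only [LinearMap.sub_apply, LinearEquiv.coe_coe, LinearMap.comp_apply,
      Submodule.subtype_apply, map_sub, hfp, sub_zero]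
    exact eq_sub_of_add_eq this
  · have := hG' v
    rw [hg, map_add, hGp] at this
    simp only [LinearMap.sub_apply, LinearEquiv.coe_coe, LinearMap.comp_apply,
      Submodule.subtype_apply, hp2, Submodule.coe_zero, sub_zero]
    exact eq_sub_of_add_eq this
  · simp only [LinearMap.sub_apply, LinearEquiv.coe_coe, LinearMap.comp_apply,
      Submodule.subtype_apply, map_sub, hpG, hp1, sub_self]

theorem opNorm_pow_le {X : Type*} [NormedAddCommGroup X] [NormedSpace ℂ X] (T : X →L[ℂ] X)
    (d : ℕ) : ‖T ^ d‖ ≤ ‖T‖ ^ d := by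
  induction d with
  | zero =>
    rw [pow_zero, pow_zero]
    exact ContinuousLinearMap.norm_id_le
  | succ d ih =>
    rw [pow_succ, pow_succ]
    exact (norm_mul_le _ _).trans (mul_le_mul_of_nonneg_right ih (norm_nonneg _))

theorem exists_inverse_of_norm_lt {X : Type*} [NormedAddCommGroup X] [NormedSpace ℂ X]
    [CompleteSpace X] {S : X →L[ℂ] X} {ρ : ℝ} (hS : ‖S‖ ≤ ρ) {a : ℂ} (ha : ρ < ‖a‖) :
    ∃ G : X →L[ℂ] X, (∀ x, (S - a • 1) (G x) = x) ∧ (∀ x, G ((S - a • 1) x) = x) ∧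
      ‖G‖ ≤ (‖a‖ - ρ)⁻¹ := by
  have hgap : 0 < ‖a‖ - ρ := sub_pos.2 ha
  -- The factor `‖1‖` is kept because `X` may be trivial, in which case it is `0`.
  have h1 : ‖S‖ * ‖(1 : X →L[ℂ] X)‖ < ‖a‖ := by
    refine lt_of_le_of_lt ?_ ha
    exact (mul_le_of_le_one_right (norm_nonneg _) ContinuousLinearMap.norm_id_le).trans hS
  have h2 : IsUnit (S - a • (1 : X →L[ℂ] X)) := by
    have := (spectrum.mem_resolventSet_iff.1 (spectrum.mem_resolventSet_of_norm_lt_mul h1)).neg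
    rwa [neg_sub, Algebra.algebraMap_eq_smul_one] at this
  obtain ⟨u, hu⟩ := h2
  have h3 : ∀ x, (S - a • (1 : X →L[ℂ] X)) ((↑u⁻¹ : X →L[ℂ] X) x) = x := fun x => by
    rw [← hu, ← mul_apply_eq_comp, u.mul_inv]; rfl
  refine ⟨↑u⁻¹, h3, fun x => ?_, ContinuousLinearMap.opNorm_le_bound _ (by positivity) fun x => ?_⟩
  · rw [← hu, ← mul_apply_eq_comp, u.inv_mul]; rfl
  · set y := (↑u⁻¹ : X →L[ℂ] X) x
    have h4 : a • y = S y - x := by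
      have := h3 x
      simp only [sub_apply, smul_apply, one_apply_eq_self] at this
      rw [← this, sub_sub_cancel]
    have h5 : ‖a‖ * ‖y‖ ≤ ρ * ‖y‖ + ‖x‖ := by
      rw [← norm_smul, h4]
      exact (norm_sub_le _ _).trans (add_le_add_left (S.le_of_opNorm_le hS y) _)
    rw [le_inv_mul_iff₀ hgap]
    linarith

/-- Fredholm inverse data for `(T₀ - a) ^ d`, where `T₀` is a block triangular operator whose
diagonal blocks are `Φ`, acting on a finite-dimensional space, and an operator of norm less than
`‖a‖`; the bounds are uniform in `T₀`. -/
theorem exists_fredholmData {F : Type} [NormedAddCommGroup F] [NormedSpace ℂ F]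
    [FiniteDimensional ℂ F] (Φ : F →L[ℂ] F) (a : ℂ) (d : ℕ)
    (hcompl : IsCompl (((Φ - a • 1) ^ d : F →L[ℂ] F) : F →ₗ[ℂ] F).ker
      (((Φ - a • 1) ^ d : F →L[ℂ] F) : F →ₗ[ℂ] F).range) {ρ : ℝ} (hρ0 : 0 ≤ ρ) (hρ : ρ < ‖a‖)
    (C : ℝ) :
    ∃ C' : ℝ, ∀ (X : Type) [NormedAddCommGroup X] [NormedSpace ℂ X] [CompleteSpace X]
      (T₀ : X →L[ℂ] X) (E : X →L[ℂ] F) (ι : F →L[ℂ] X), ‖T₀‖ ≤ C → ‖E‖ ≤ C → ‖ι‖ ≤ C →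
      (∀ v, E (ι v) = v) → (∀ x, E (T₀ x) = Φ (E x)) → (∀ x, E x = 0 → ‖T₀ x‖ ≤ ρ * ‖x‖) →
      ∃ (J : (((Φ - a • 1) ^ d : F →L[ℂ] F) : F →ₗ[ℂ] F).ker →L[ℂ] X)
        (e : X →L[ℂ] (((Φ - a • 1) ^ d : F →L[ℂ] F) : F →ₗ[ℂ] F).ker) (L : X →L[ℂ] X),
        ‖J‖ ≤ C' ∧ ‖e‖ ≤ C' ∧ ‖L‖ ≤ C' ∧
        (∀ v, e (J v) = v) ∧ (∀ x, e (L x) = 0) ∧ (∀ x, e (((T₀ - a • 1) ^ d) x) = 0) ∧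
        (∀ v, ((T₀ - a • 1) ^ d) (J v) = 0) ∧
        (∀ x, e x = 0 → ((T₀ - a • 1) ^ d) (L x) = x) ∧
        (∀ x, L (((T₀ - a • 1) ^ d) x) = x - J (e x)) := by
  set f : F →L[ℂ] F := (Φ - a • 1) ^ d with hf
  set V := (f : F →ₗ[ℂ] F).ker with hV
  obtain ⟨N₀, p₀, hfN, hNf, hpN, hp, hpf⟩ := exists_pseudoInverse (f : F →ₗ[ℂ] F) hcompl
  let N : F →L[ℂ] F := LinearMap.toContinuousLinearMap N₀
  let p : F →L[ℂ] V := LinearMap.toContinuousLinearMap p₀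
  let q := (C + ‖a‖) ^ d
  let g := (‖a‖ - ρ)⁻¹ ^ d
  let CJ := C + g * (q * C)
  let Ce := ‖p‖ * C
  let CL := C * ‖N‖ * C + g * (1 + q * C * ‖N‖ * C + C * ‖p‖ * C)
  refine ⟨max CJ (max Ce CL), ?_⟩
  intro X _ _ _ T₀ E ι hT hE hι hEι hET hker
  have hC : 0 ≤ C := (norm_nonneg _).trans hE
  set Q₀ : X →L[ℂ] X := (T₀ - a • 1) ^ d with hQ₀
  have hq : 0 ≤ q := by positivity
  have hg : 0 ≤ g := pow_nonneg (inv_nonneg.2 (sub_pos.2 hρ).le) d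
  have hQn : ‖Q₀‖ ≤ q := by
    refine (opNorm_pow_le _ d).trans (pow_le_pow_left₀ (norm_nonneg _) ?_ d)
    refine (norm_sub_le _ _).trans (add_le_add hT ?_)
    rw [norm_smul]
    exact mul_le_of_le_one_right (norm_nonneg _) ContinuousLinearMap.norm_id_le
  have hEQ : ∀ x, E (Q₀ x) = f (E x) := by
    have h : ∀ (j : ℕ) x, E (((T₀ - a • (1 : X →L[ℂ] X)) ^ j) x) =
        ((Φ - a • (1 : F →L[ℂ] F)) ^ j) (E x) := by
      intro j
      induction j with
      | zero => intro x; rfl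
      | succ j ih =>
        intro x
        rw [pow_succ, mul_apply_eq_comp, ih, pow_succ, mul_apply_eq_comp]
        simp [hET]
    exact h d
  let K := (E : X →ₗ[ℂ] F).ker
  have hKc : IsClosed (K : Set X) := E.isClosed_ker
  have : CompleteSpace K := hKc.completeSpace_coe
  have hinv : ∀ x ∈ K, T₀ x ∈ K := fun x hx => by
    have hx : E x = 0 := hx
    change E (T₀ x) = 0
    rw [hET, hx, map_zero]
  let S : K →L[ℂ] K := T₀.restrict hinv
  have hSn : ‖S‖ ≤ ρ := ContinuousLinearMap.opNorm_le_bound _ hρ0 fun x => hker x x.2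
  obtain ⟨G₁, hG1, hG2, hGn⟩ := exists_inverse_of_norm_lt hSn hρ
  have hApow : ∀ (j : ℕ) (x : K), (((S - a • (1 : K →L[ℂ] K)) ^ j) x : X) =
      ((T₀ - a • (1 : X →L[ℂ] X)) ^ j) x := by
    intro j
    induction j with
    | zero => intro x; rfl
    | succ j ih =>
      intro x
      rw [pow_succ, mul_apply_eq_comp, ih, pow_succ, mul_apply_eq_comp]
      rfl
  let G : K →L[ℂ] K := G₁ ^ d
  have hGd : ‖G‖ ≤ g := (opNorm_pow_le _ d).trans (pow_le_pow_left₀ (norm_nonneg _) hGn d)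
  have hG1d : ∀ x : K, Q₀ (G x) = x := by
    have h : (S - a • (1 : K →L[ℂ] K)) ^ d * G₁ ^ d = 1 := by
      have h1 : (S - a • (1 : K →L[ℂ] K)) * G₁ = 1 := ContinuousLinearMap.ext hG1
      have h2 : G₁ * (S - a • (1 : K →L[ℂ] K)) = 1 := ContinuousLinearMap.ext hG2
      rw [← Commute.mul_pow (show Commute _ _ from h1.trans h2.symm), h1, one_pow]
    intro x
    rw [← hApow, ← mul_apply_eq_comp, h]
    rfl
  have hG2d : ∀ x y : K, (y : X) = Q₀ x → G y = x := by
    have h : G₁ ^ d * (S - a • (1 : K →L[ℂ] K)) ^ d = 1 := by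
      have h1 : (S - a • (1 : K →L[ℂ] K)) * G₁ = 1 := ContinuousLinearMap.ext hG1
      have h2 : G₁ * (S - a • (1 : K →L[ℂ] K)) = 1 := ContinuousLinearMap.ext hG2
      rw [← Commute.mul_pow (show Commute _ _ from h2.trans h1.symm), h2, one_pow]
    intro x y hy
    have : y = ((S - a • (1 : K →L[ℂ] K)) ^ d) x := Subtype.ext (hy.trans (hApow d x).symm)
    rw [this, ← mul_apply_eq_comp, h]
    rfl
  have hEG : ∀ x : K, E x = 0 := fun x => x.2
  -- `H` is what remains of `x` after solving its `F` component by `N` and removing the unsolvable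
  -- part `p (E x)`. It lies in `ker E`, where `G` inverts `Q₀`.
  let H : X →L[ℂ] K := (1 - Q₀ ∘L ι ∘L N ∘L E - ι ∘L V.subtypeL ∘L p ∘L E).codRestrict K
    (fun x => by
      change E (x - Q₀ (ι (N (E x))) - ι (p (E x))) = 0
      rw [map_sub, map_sub, hEQ, hEι, hEι, sub_sub, sub_eq_zero]
      exact (sub_add_cancel _ _).symm.trans (congrArg (· + _) (hfN (E x)).symm))
  have hH : ∀ x, (H x : X) = x - Q₀ (ι (N (E x))) - ι (p (E x)) := fun x => rfl
  let H' : V →L[ℂ] K := (Q₀ ∘L ι ∘L V.subtypeL).codRestrict K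
    (fun v => by
      change E (Q₀ (ι v)) = 0
      rw [hEQ, hEι]
      exact v.2)
  have hH' : ∀ v, (H' v : X) = Q₀ (ι v) := fun v => rfl
  -- The lift `ι v` of a kernel vector of `f` need not be killed by `Q₀`, but `Q₀ (ι v)` lies in
  -- `ker E`; subtracting its preimage under `Q₀` corrects this.
  let J : V →L[ℂ] X := ι ∘L V.subtypeL - K.subtypeL ∘L G ∘L H'
  have hJ : ∀ v, J v = ι v - G (H' v) := fun v => rfl
  let e : X →L[ℂ] V := p ∘L E
  have he : ∀ x, e x = p (E x) := fun x => rfl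
  let L : X →L[ℂ] X := ι ∘L N ∘L E + K.subtypeL ∘L G ∘L H
  have hL : ∀ x, L x = ι (N (E x)) + G (H x) := fun x => rfl
  refine ⟨J, e, L, le_max_of_le_left ?_, le_max_of_le_right (le_max_of_le_left ?_),
    le_max_of_le_right (le_max_of_le_right ?_), fun v => ?_, fun x => ?_, fun x => ?_,
    fun v => ?_, fun x hx => ?_, fun x => ?_⟩
  · refine ContinuousLinearMap.opNorm_le_bound _ (by positivity) fun v => ?_
    rw [hJ, add_mul, mul_assoc]
    have h1 : ‖H' v‖ ≤ q * C * ‖v‖ := by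
      rw [mul_assoc]
      exact Q₀.le_of_opNorm_le_of_le hQn (ι.le_of_opNorm_le hι v)
    exact (norm_sub_le _ _).trans (add_le_add (ι.le_of_opNorm_le hι v)
      (G.le_of_opNorm_le_of_le hGd h1))
  · exact (ContinuousLinearMap.opNorm_comp_le _ _).trans
      (mul_le_mul_of_nonneg_left hE (norm_nonneg p))
  · refine ContinuousLinearMap.opNorm_le_bound _ (by positivity) fun x => ?_
    have hNE : ‖ι (N (E x))‖ ≤ C * (‖N‖ * (C * ‖x‖)) :=
      ι.le_of_opNorm_le_of_le hι (N.le_opNorm_of_le (E.le_of_opNorm_le hE x))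
    have hH1 : ‖H x‖ ≤ ‖x‖ + q * (C * (‖N‖ * (C * ‖x‖))) + C * (‖p‖ * (C * ‖x‖)) := by
      change ‖(H x : X)‖ ≤ _
      rw [hH]
      refine (norm_sub_le _ _).trans (add_le_add ((norm_sub_le _ _).trans (add_le_add le_rfl ?_)) ?_)
      · exact Q₀.le_of_opNorm_le_of_le hQn hNE
      · exact ι.le_of_opNorm_le_of_le hι (p.le_opNorm_of_le (E.le_of_opNorm_le hE x))
    rw [hL]
    refine ((norm_add_le _ _).trans (add_le_add hNE (G.le_of_opNorm_le_of_le hGd hH1))).trans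
      (le_of_eq ?_)
    simp only [CL]
    ring
  · rw [he, hJ, map_sub, hEG, sub_zero, hEι]
    exact hp v
  · rw [he, hL, map_add, hEG, add_zero, hEι]
    exact hpN _
  · rw [he, hEQ]
    exact hpf _
  · rw [hJ, map_sub, hG1d, hH', sub_self]
  · rw [hL, map_add, hG1d, hH, ← he, hx, Submodule.coe_zero, map_zero, sub_zero, add_sub_cancel]
  · have hN : N (E (Q₀ x)) = E x - p (E x) := by
      rw [hEQ]
      exact hNf _
    have hpQ : p (E (Q₀ x)) = 0 := by
      rw [hEQ]
      exact hpf _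
    have hx : x - ι (E x) ∈ K := by
      change E (x - ι (E x)) = 0
      rw [map_sub, hEι, sub_self]
    have h1 : G (H (Q₀ x) - H' (p (E x))) = ⟨x - ι (E x), hx⟩ := by
      refine hG2d _ _ ?_
      rw [Submodule.coe_sub, hH, hH', hN, hpQ]
      simp only [map_sub, Submodule.coe_zero, map_zero, sub_zero]
      abel
    rw [map_sub, sub_eq_iff_eq_add] at h1
    have h2 : ι (N (E (Q₀ x))) = ι (E x) - ι (p (E x)) := by rw [hN, map_sub]
    have h3 : (G (H (Q₀ x)) : X) = x - ι (E x) + G (H' (p (E x))) := congrArg Subtype.val h1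
    rw [hL, hJ, he, h2, h3]
    abel

/-! ### Perturbation of regular points and of eigenvalues, uniformly in the space. -/

theorem norm_pow_sub_pow_le {X : Type*} [NormedAddCommGroup X] [NormedSpace ℂ X]
    {S T : X →L[ℂ] X} {M : ℝ} (hM : 1 ≤ M) (hS : ‖S‖ ≤ M) (hT : ‖T‖ ≤ M) (d : ℕ) :
    ‖S ^ d - T ^ d‖ ≤ d * M ^ d * ‖S - T‖ := by
  have hM0 : 0 ≤ M := zero_le_one.trans hM
  induction d with
  | zero => simp
  | succ d ih =>
    have h : S ^ (d + 1) - T ^ (d + 1) = S * (S ^ d - T ^ d) + (S - T) * T ^ d := by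
      rw [pow_succ', pow_succ']
      noncomm_ring
    rw [h]
    have h1 : ‖S * (S ^ d - T ^ d)‖ ≤ M * (d * M ^ d * ‖S - T‖) :=
      (norm_mul_le _ _).trans (mul_le_mul hS ih (norm_nonneg _) hM0)
    have h2 : ‖(S - T) * T ^ d‖ ≤ ‖S - T‖ * M ^ (d + 1) := by
      refine (norm_mul_le _ _).trans (mul_le_mul_of_nonneg_left ?_ (norm_nonneg _))
      exact ((opNorm_pow_le T d).trans (pow_le_pow_left₀ (norm_nonneg _) hT d)).trans
        (pow_le_pow_right₀ hM (Nat.le_succ d))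
    refine (norm_add_le _ _).trans ((add_le_add h1 h2).trans (le_of_eq ?_))
    push_cast
    ring

/-- Perturbation of a regular point of a block triangular operator. -/
theorem exists_mem_resolventSet_of_norm_sub_le {F : Type} [NormedAddCommGroup F]
    [NormedSpace ℂ F] [FiniteDimensional ℂ F] (Φ : F →L[ℂ] F) {a : ℂ}
    (hΦ : ¬ Module.End.HasEigenvalue (Φ : F →ₗ[ℂ] F) a) {ρ : ℝ} (hρ0 : 0 ≤ ρ) (hρ : ρ < ‖a‖)
    (C : ℝ) :
    ∃ η : ℝ, 0 < η ∧ ∀ (X : Type) [NormedAddCommGroup X] [NormedSpace ℂ X] [CompleteSpace X]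
      (T₀ T : X →L[ℂ] X) (E : X →L[ℂ] F) (ι : F →L[ℂ] X), ‖T₀‖ ≤ C → ‖E‖ ≤ C → ‖ι‖ ≤ C →
      (∀ v, E (ι v) = v) → (∀ x, E (T₀ x) = Φ (E x)) → (∀ x, E x = 0 → ‖T₀ x‖ ≤ ρ * ‖x‖) →
      ‖T - T₀‖ ≤ η → a ∈ resolventSet ℂ T := by
  have hker : (((Φ - a • 1) ^ 1 : F →L[ℂ] F) : F →ₗ[ℂ] F).ker = ⊥ := by
    rw [pow_one, LinearMap.ker_eq_bot']
    intro v hv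
    by_contra hv0
    refine hΦ (Module.End.hasEigenvalue_of_hasEigenvector (x := v)
      ⟨Module.End.mem_genEigenspace_one.2 ?_, hv0⟩)
    exact sub_eq_zero.1 hv
  have hcompl : IsCompl (((Φ - a • 1) ^ 1 : F →L[ℂ] F) : F →ₗ[ℂ] F).ker
      (((Φ - a • 1) ^ 1 : F →L[ℂ] F) : F →ₗ[ℂ] F).range := by
    rw [hker, LinearMap.range_eq_top.2 (LinearMap.surjective_of_injective
      (LinearMap.ker_eq_bot.1 hker))]
    exact isCompl_bot_top
  obtain ⟨C', hC'⟩ := exists_fredholmData Φ a 1 hcompl hρ0 hρ C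
  have hc : 0 < |C'| + 1 := by positivity
  refine ⟨(|C'| + 1)⁻¹ / 2, by positivity, ?_⟩
  intro X _ _ _ T₀ T E ι hT hE hι hEι hET hkr hη
  obtain ⟨J, e, L, -, -, hL, -, -, -, -, hQL, hLQ⟩ := hC' X T₀ E ι hT hE hι hEι hET hkr
  -- The kernel of `Φ - a` is trivial, so `e` vanishes and `L` is a two-sided inverse of `T₀ - a`.
  have he : ∀ x, e x = 0 := fun x =>
    Subtype.ext ((Submodule.mem_bot ℂ).1 (hker.le (e x).2))
  have h1 : (T₀ - a • (1 : X →L[ℂ] X)) * L = 1 := ContinuousLinearMap.ext fun x => by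
    have := hQL x (he x)
    rwa [pow_one] at this
  have h2 : L * (T₀ - a • (1 : X →L[ℂ] X)) = 1 := ContinuousLinearMap.ext fun x => by
    have := hLQ x
    rwa [he, map_zero, sub_zero, pow_one] at this
  have hu : IsUnit (T₀ - a • (1 : X →L[ℂ] X)) := ⟨⟨_, _, h1, h2⟩, rfl⟩
  have hsmall : ‖-(L * (T - T₀))‖ < 1 := by
    rw [norm_neg]
    calc ‖L * (T - T₀)‖ ≤ ‖L‖ * ‖T - T₀‖ := norm_mul_le _ _
      _ ≤ (|C'| + 1) * ((|C'| + 1)⁻¹ / 2) := by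
        gcongr
        exact hL.trans ((le_abs_self _).trans (by linarith))
      _ < 1 := by rw [← mul_div_assoc, mul_inv_cancel₀ hc.ne']; norm_num
  -- The factorization is `T - a = (T₀ - a) (1 + L (T - T₀))`.
  have hw := hu.mul (isUnit_one_sub_of_norm_lt_one hsmall)
  rw [sub_neg_eq_add, mul_add, mul_one, ← mul_assoc, h1, one_mul] at hw
  rw [spectrum.mem_resolventSet_iff, Algebra.algebraMap_eq_smul_one]
  have := hw.neg
  convert this using 1
  abel

/-- The total multiplicity near an eigenvalue of the finite-dimensional diagonal block of a block
triangular operator is stable under small perturbations. -/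
theorem exists_finsum_finrank_eq_of_norm_sub_le {F : Type} [NormedAddCommGroup F]
    [NormedSpace ℂ F] [FiniteDimensional ℂ F] (Φ : F →L[ℂ] F) (a : ℂ)
    {ρ : ℝ} (hρ0 : 0 ≤ ρ) (hρ : ρ < ‖a‖) (C : ℝ) :
    ∃ ρ₀ : ℝ, 0 < ρ₀ ∧ ∀ ρ₁ : ℝ, 0 < ρ₁ → ρ₁ ≤ ρ₀ →
      ∃ η : ℝ, 0 < η ∧ ∀ (X : Type) [NormedAddCommGroup X] [NormedSpace ℂ X] [CompleteSpace X]
      (T₀ T : X →L[ℂ] X) (E : X →L[ℂ] F) (ι : F →L[ℂ] X), ‖T₀‖ ≤ C → ‖E‖ ≤ C → ‖ι‖ ≤ C →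
      (∀ v, E (ι v) = v) → (∀ x, E (T₀ x) = Φ (E x)) → (∀ x, E x = 0 → ‖T₀ x‖ ≤ ρ * ‖x‖) →
      ‖T - T₀‖ ≤ η → ∀ D : Set ℂ, Metric.closedBall a ρ₁ ⊆ D → D ⊆ Metric.ball a ρ₀ →
      (D ∩ {lam | Module.End.HasEigenvalue (T : X →ₗ[ℂ] X) lam}).Finite ∧
      (∀ lam ∈ D, FiniteDimensional ℂ (Module.End.maxGenEigenspace (T : X →ₗ[ℂ] X) lam)) ∧
      ∑ᶠ lam ∈ D ∩ {lam | Module.End.HasEigenvalue (T : X →ₗ[ℂ] X) lam},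
        Module.finrank ℂ (Module.End.maxGenEigenspace (T : X →ₗ[ℂ] X) lam) =
        Module.finrank ℂ (Module.End.maxGenEigenspace (Φ : F →ₗ[ℂ] F) a) := by
  have hpow : ∀ d : ℕ, (((Φ - a • 1) ^ d : F →L[ℂ] F) : F →ₗ[ℂ] F) =
      ((Φ : F →ₗ[ℂ] F) - a • (1 : Module.End ℂ F)) ^ d := fun d => by
    rw [ContinuousLinearMap.toLinearMap_pow]
    rfl
  -- For large `d` the kernel and range of `(Φ - a)^d` are complementary; `d > dim F` also makes the
  -- kernel the full generalized eigenspace and ensures `d ≠ 0`.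
  obtain ⟨d, hcompl, hd⟩ := ((((Φ : F →ₗ[ℂ] F) -
    a • (1 : Module.End ℂ F)).eventually_isCompl_ker_pow_range_pow).and
      (eventually_ge_atTop (Module.finrank ℂ F + 1))).exists
  rw [← hpow] at hcompl
  have hd0 : d ≠ 0 := by omega
  have hV : Module.End.maxGenEigenspace (Φ : F →ₗ[ℂ] F) a =
      (((Φ - a • 1) ^ d : F →L[ℂ] F) : F →ₗ[ℂ] F).ker := by
    rw [hpow, ← Module.End.genEigenspace_nat, Module.End.maxGenEigenspace_eq_genEigenspace_finrank]
    exact (Module.End.genEigenspace_eq_genEigenspace_finrank_of_le _ _ (by omega)).symm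
  rw [hV]
  obtain ⟨C', hC'⟩ := exists_fredholmData Φ a d hcompl hρ0 hρ C
  set c := |C'| + 1 with hcdef
  have hc : 0 < c := by positivity
  have hcC : C' ≤ c := (le_abs_self _).trans (by linarith)
  refine ⟨min 1 (1 / (4 * c)), by positivity, fun ρ₁ hρ₁ hρ₁₀ => ?_⟩
  set ρ₀ := min 1 (1 / (4 * c)) with hρ₀
  have hρ₀0 : 0 < ρ₀ := by positivity
  set M := |C| + 2 + ‖a‖ with hM
  have hM1 : 1 ≤ M := by
    have := norm_nonneg a
    have := abs_nonneg C
    linarith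
  have hdM : 0 < d * M ^ d := by
    have : 0 < d := Nat.pos_of_ne_zero hd0
    positivity
  set w := min (1 / (4 * c)) (ρ₁ ^ d / (4 * c ^ 2)) with hw
  have hw0 : 0 < w := by positivity
  refine ⟨min 1 (w / (d * M ^ d)), by positivity, ?_⟩
  intro X _ _ _ T₀ T E ι hT hE hι hEι hET hkr hη D hD₁ hD₀
  obtain ⟨J, e, L, hJ, he, hL, h1, h2, h3, h4, h5, h6⟩ := hC' X T₀ E ι hT hE hι hEι hET hkr
  have hsub : ∀ S : X →L[ℂ] X, ‖S‖ ≤ |C| + 1 → ‖S - a • (1 : X →L[ℂ] X)‖ ≤ M := fun S hS => by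
    have : ‖a • (1 : X →L[ℂ] X)‖ ≤ ‖a‖ := by
      rw [norm_smul]
      exact mul_le_of_le_one_right (norm_nonneg _) ContinuousLinearMap.norm_id_le
    refine (norm_sub_le _ _).trans ?_
    linarith
  have hQ : ‖(T - a • (1 : X →L[ℂ] X)) ^ d - (T₀ - a • (1 : X →L[ℂ] X)) ^ d‖ ≤ w := by
    have hT₀ : ‖T₀‖ ≤ |C| := hT.trans (le_abs_self C)
    refine (norm_pow_sub_pow_le hM1 (hsub T ?_) (hsub T₀ (by linarith)) d).trans ?_
    · have : T = T₀ + (T - T₀) := by abel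
      rw [this]
      exact (norm_add_le _ _).trans (add_le_add hT₀ (hη.trans (min_le_left _ _)))
    · rw [sub_sub_sub_cancel_right, ← le_div_iff₀' hdM]
      exact hη.trans (min_le_right _ _)
  have hbij : ∀ r : ℝ, ρ₁ ^ d ≤ r → r ≤ ρ₀ → Function.Bijective (e.toLinearMap.domRestrict
      (decaySubspace ((T - a • (1 : X →L[ℂ] X)) ^ d) r)) := by
    intro r hr1 hr0
    have hr : 0 < r := (pow_pos hρ₁ d).trans_le hr1
    refine bijective_decaySubspace hr h1 h2 h3 h4 h5 h6 ?_
    set q := ‖(T - a • (1 : X →L[ℂ] X)) ^ d - (T₀ - a • (1 : X →L[ℂ] X)) ^ d‖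
    have hq0 : 0 ≤ q := norm_nonneg _
    have e1 : ‖L‖ * (r + q) ≤ c * (1 / (4 * c) + 1 / (4 * c)) := by
      have hr' : r ≤ 1 / (4 * c) := hr0.trans (min_le_right _ _)
      have hq' : q ≤ 1 / (4 * c) := hQ.trans (min_le_left _ _)
      have hL' := hL.trans hcC
      gcongr
    have e2 : r⁻¹ * (‖J‖ * ‖e‖ * q) ≤ r⁻¹ * (c * c * (r / (4 * c ^ 2))) := by
      have hq' : q ≤ r / (4 * c ^ 2) := (hQ.trans (min_le_right _ _)).trans (by gcongr)
      have hJ' := hJ.trans hcC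
      have he' := he.trans hcC
      gcongr
    have e3 : c * (1 / (4 * c) + 1 / (4 * c)) = 1 / 2 := by field_simp; norm_num
    have e4 : r⁻¹ * (c * c * (r / (4 * c ^ 2))) = 1 / 4 := by field_simp
    linarith
  have hp0 : ρ₀ ^ d ≤ ρ₀ := pow_le_of_le_one hρ₀0.le (min_le_left _ _) hd0
  have hp1 : ρ₁ ^ d ≤ ρ₀ ^ d := pow_le_pow_left₀ hρ₁.le hρ₁₀ d
  let E₁ := LinearEquiv.ofBijective _ (hbij _ le_rfl (hp1.trans hp0))
  let E₀ := LinearEquiv.ofBijective _ (hbij _ hp1 hp0)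
  have : FiniteDimensional ℂ (decaySubspace ((T - a • (1 : X →L[ℂ] X)) ^ d) (ρ₀ ^ d)) :=
    E₀.symm.finiteDimensional
  have key := finsum_finrank_of_decaySubspace T a hd0 hρ₁ hρ₁₀ hD₁ hD₀
    (E₁.finrank_eq.trans E₀.finrank_eq.symm)
  rwa [E₀.finrank_eq] at key

/-! ### Linear differential equations and their propagators. -/

theorem exists_norm_mulVec_le {n : ℕ} {A : ℝ → Matrix (Fin n) (Fin n) ℂ} (hA : Continuous A)
    (a b : ℝ) : ∃ K, 0 < K ∧ ∀ t ∈ Icc a b, ∀ v, ‖A t *ᵥ v‖ ≤ K * ‖v‖ := by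
  obtain ⟨F, hF, hF'⟩ := exists_clm hA
  obtain ⟨K, hK⟩ := isCompact_Icc.exists_bound_of_continuousOn (s := Icc a b) hF.continuousOn
  refine ⟨|K| + 1, by positivity, fun t ht v => ?_⟩
  rw [← hF']
  refine (F t).le_of_opNorm_le ((hK t ht).trans ((le_abs_self K).trans ?_)) v
  linarith

theorem norm_le_gronwallBound_of_linear {n : ℕ} {A : ℝ → Matrix (Fin n) (Fin n) ℂ} {K ε a b : ℝ}
    (hK : ∀ t ∈ Icc a b, ∀ v, ‖A t *ᵥ v‖ ≤ K * ‖v‖) {y g : ℝ → Fin n → ℂ}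
    (hg : ∀ t ∈ Icc a b, ‖g t‖ ≤ ε)
    (hy : ∀ t ∈ Icc a b, HasDerivWithinAt y (A t *ᵥ y t + g t) (Icc a b) t) :
    ∀ t ∈ Icc a b, ‖y t‖ ≤ gronwallBound ‖y a‖ K ε (t - a) := by
  refine norm_le_gronwallBound_of_norm_deriv_right_le
    (fun t ht => (hy t ht).continuousWithinAt)
    (fun t ht => (hy t (Ico_subset_Icc_self ht)).mono_of_mem_nhdsWithin
      (Icc_mem_nhdsGE_of_mem ht)) le_rfl fun t ht => ?_
  have ht' := Ico_subset_Icc_self ht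
  exact (norm_add_le _ _).trans (add_le_add (hK t ht' _) (hg t ht'))

theorem eqOn_of_linear_ode {n : ℕ} {A : ℝ → Matrix (Fin n) (Fin n) ℂ} (hA : Continuous A)
    {a b : ℝ} {g x y : ℝ → Fin n → ℂ}
    (hx : ∀ t ∈ Icc a b, HasDerivWithinAt x (A t *ᵥ x t + g t) (Icc a b) t)
    (hy : ∀ t ∈ Icc a b, HasDerivWithinAt y (A t *ᵥ y t + g t) (Icc a b) t) (h : x a = y a) :
    ∀ t ∈ Icc a b, x t = y t := by
  obtain ⟨K, -, hK⟩ := exists_norm_mulVec_le hA a b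
  intro t ht
  have := norm_le_gronwallBound_of_linear (y := x - y) (g := 0) (ε := 0) hK (by simp)
    (fun t ht => by
      refine ((hx t ht).sub (hy t ht)).congr_deriv ?_
      simp only [Pi.sub_apply, Pi.zero_apply, Matrix.mulVec_sub]
      abel) t ht
  simp only [Pi.sub_apply, h, sub_self, norm_zero, gronwallBound_ε0_δ0] at this
  exact sub_eq_zero.1 (norm_le_zero_iff.1 this)

/-- The chosen propagator is only known to come from some solution; uniqueness, by Gronwall, makes
it act on every solution. -/
theorem propagator_mulVec {n : ℕ} {A : ℝ → Matrix (Fin n) (Fin n) ℝ} (hA : Continuous A)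
    {s t : ℝ} (hst : s ≤ t) {μ : ℂ} {y : ℝ → Fin n → ℂ}
    (hy : ∀ r ∈ Icc s t, HasDerivWithinAt y ((toComplex (A r) - μ • 1) *ᵥ y r) (Icc s t) r) :
    propagator A t s μ *ᵥ y s = y t := by
  obtain ⟨x, hxs, hxt, hx⟩ := isPropagator_propagator hA hst μ (y s)
  rw [← hxt]
  refine eqOn_of_linear_ode (A := fun r => toComplex (A r) - μ • (1 : Matrix (Fin n) (Fin n) ℂ))
    (g := 0) ((continuous_toComplex hA).sub continuous_const) ?_ ?_ hxs t ⟨hst, le_rfl⟩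
  · simpa using hx
  · simpa using hy

/-- A solution curve that represents all propagators from its initial time. -/
theorem exists_solution {n : ℕ} {A : ℝ → Matrix (Fin n) (Fin n) ℝ} (hA : Continuous A)
    {s b : ℝ} (hsb : s ≤ b) (μ : ℂ) (v : Fin n → ℂ) :
    ∃ y : ℝ → Fin n → ℂ, y s = v ∧ (∀ r ∈ Icc s b,
      HasDerivWithinAt y ((toComplex (A r) - μ • 1) *ᵥ y r) (Icc s b) r) ∧
      ∀ t ∈ Icc s b, propagator A t s μ *ᵥ v = y t := by
  obtain ⟨y, hys, -, hy⟩ := isPropagator_propagator hA hsb μ v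
  refine ⟨y, hys, hy, fun t ht => ?_⟩
  rw [← hys]
  exact propagator_mulVec hA ht.1 fun r hr =>
    (hy r ⟨hr.1, hr.2.trans ht.2⟩).mono (Icc_subset_Icc_right ht.2)

theorem propagator_self {n : ℕ} {A : ℝ → Matrix (Fin n) (Fin n) ℝ} (hA : Continuous A)
    (s : ℝ) (μ : ℂ) : propagator A s s μ = 1 := by
  refine Matrix.ext_of_mulVec_single fun i => ?_
  obtain ⟨y, hys, -, hy⟩ := exists_solution hA (le_refl s) μ (Pi.single i 1)
  rw [hy s ⟨le_rfl, le_rfl⟩, hys, Matrix.one_mulVec]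

theorem propagator_mul_propagator {n : ℕ} {A : ℝ → Matrix (Fin n) (Fin n) ℝ} (hA : Continuous A)
    {s r t : ℝ} (hsr : s ≤ r) (hrt : r ≤ t) (μ : ℂ) :
    propagator A t r μ * propagator A r s μ = propagator A t s μ := by
  refine Matrix.ext_of_mulVec_single fun i => ?_
  obtain ⟨y, -, hy, hyU⟩ := exists_solution hA (hsr.trans hrt) μ (Pi.single i 1)
  rw [← Matrix.mulVec_mulVec, hyU r ⟨hsr, hrt⟩, hyU t ⟨hsr.trans hrt, le_rfl⟩]
  exact propagator_mulVec hA hrt fun q hq =>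
    (hy q ⟨hsr.trans hq.1, hq.2⟩).mono (Icc_subset_Icc_left hsr)

theorem continuousOn_propagator_mulVec {n : ℕ} {A : ℝ → Matrix (Fin n) (Fin n) ℝ}
    (hA : Continuous A) {s b : ℝ} (hsb : s ≤ b) (μ : ℂ) (v : Fin n → ℂ) :
    ContinuousOn (fun t => propagator A t s μ *ᵥ v) (Icc s b) := by
  obtain ⟨y, -, hy, hyU⟩ := exists_solution hA hsb μ v
  exact ContinuousOn.congr (fun t ht => (hy t ht).continuousWithinAt) hyU

/-- If `y' = A y` on `[0, 1]`, then by periodicity `exp (-μ (t + 1)) y (t + 1)` solves the equation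
with `A - μ` on `[-1, 0]`. -/
theorem propagator_zero_neg_one {n : ℕ} {A : ℝ → Matrix (Fin n) (Fin n) ℝ} (hA : Continuous A)
    (hper : Function.Periodic A 1) (μ : ℂ) :
    propagator A 0 (-1) μ = Complex.exp (-μ) • propagator A 1 0 0 := by
  refine Matrix.ext_of_mulVec_single fun i => ?_
  obtain ⟨y, hy0, hy, hyU⟩ := exists_solution hA zero_le_one 0 (Pi.single i 1)
  rw [Matrix.smul_mulVec, hyU 1 ⟨zero_le_one, le_rfl⟩]
  set x : ℝ → Fin n → ℂ := fun t => Complex.exp (-μ * (t + 1 : ℝ)) • y (t + 1) with hx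
  have h0 : x (-1) = Pi.single i 1 := by simp [hx, hy0]
  have h1 : x 0 = Complex.exp (-μ) • y 1 := by simp [hx]
  rw [← h0, ← h1]
  refine propagator_mulVec hA (by norm_num) fun r hr => ?_
  have hr1 : r + 1 ∈ Icc (0 : ℝ) 1 := ⟨by linarith [hr.1], by linarith [hr.2]⟩
  have hmaps : MapsTo (fun t : ℝ => t + 1) (Icc (-1) 0) (Icc 0 1) := fun t ht =>
    ⟨by linarith [ht.1], by linarith [ht.2]⟩
  have d1 : HasDerivWithinAt (fun t : ℝ => y (t + 1)) (toComplex (A r) *ᵥ y (r + 1))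
      (Icc (-1) 0) r := by
    have h := (hy (r + 1) hr1).scomp r ((hasDerivWithinAt_id r (Icc (-1 : ℝ) 0)).add_const 1) hmaps
    exact h.congr_deriv (by simp [hper r])
  have d2 : HasDerivWithinAt (fun t : ℝ => Complex.exp (-μ * (t + 1 : ℝ)))
      (Complex.exp (-μ * (r + 1 : ℝ)) * -μ) (Icc (-1) 0) r := by
    have h : HasDerivAt (fun t : ℝ => -μ * ((t + 1 : ℝ) : ℂ)) (-μ) r := by
      simpa using (((hasDerivAt_id r).add_const (1 : ℝ)).ofReal_comp.const_mul (-μ))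
    exact h.cexp.hasDerivWithinAt
  refine (d2.smul d1).congr_deriv ?_
  rw [Matrix.sub_mulVec, Matrix.smul_mulVec, Matrix.one_mulVec, Matrix.mulVec_smul, mul_smul,
    sub_eq_add_neg, smul_comm, neg_smul]

/-! ### The characteristic function at `z = 0`. -/

theorem det_prod_of_lower {R α β : Type*} [CommRing R] [Fintype α] [LinearOrder α]
    [Fintype β] [DecidableEq β] (M : Matrix (α × β) (α × β) R)
    (h : ∀ p q, p.1 < q.1 → M p q = 0) :
    M.det = ∏ i, (Matrix.of fun a b => M (i, a) (i, b)).det := by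
  have hM : M.BlockTriangular fun p => OrderDual.toDual p.1 := fun p q hpq => h p q hpq
  rw [hM.det_fintype]
  refine Fintype.prod_equiv OrderDual.ofDual _ _ fun k => ?_
  let e : β ≃ {p : α × β // OrderDual.toDual p.1 = k} :=
    { toFun := fun a => ⟨(OrderDual.ofDual k, a), rfl⟩
      invFun := fun p => p.1.2
      left_inv := fun a => rfl
      right_inv := by
        rintro ⟨⟨i, a⟩, rfl⟩
        rfl }
  rw [← Matrix.det_submatrix_equiv_self e]
  rfl

/-- The determinant of `1 - C`, where `C` is the cyclic block matrix with blocks `U j`. -/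
theorem det_cyclic {R : Type*} [CommRing R] {m n : ℕ}
    (U : Fin (m + 1) → Matrix (Fin n) (Fin n) R) (x : ℕ → Matrix (Fin n) (Fin n) R)
    (hx0 : x 0 = 1) (hx : ∀ j : Fin (m + 1), x (j + 1) = U j * x j)
    (Δ : Matrix (Fin (m + 1) × Fin n) (Fin (m + 1) × Fin n) R)
    (hΔ : ∀ j a q, Δ (j + 1, a) q = (1 : Matrix (Fin (m + 1) × Fin n) (Fin (m + 1) × Fin n) R)
      (j + 1, a) q - if j = q.1 then U j a q.2 else 0) :
    Δ.det = (1 - x (m + 1)).det := by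
  -- Block column `0` of `T` is an orbit of the recursion, so `Δ * T` vanishes there except where
  -- the cycle closes, which leaves `1 - x (m + 1)`. Since `x 0 = 1`, `T` is block unipotent.
  let T : Matrix (Fin (m + 1) × Fin n) (Fin (m + 1) × Fin n) R :=
    Matrix.of fun p q => if q.1 = 0 then x p.1 p.2 q.2 else (1 : Matrix _ _ R) p q
  have hT0 : ∀ p b, T p (0, b) = x p.1 p.2 b := fun p b => by simp [T]
  have hT1 : ∀ p q, q.1 ≠ 0 → T p q = (1 : Matrix _ _ R) p q := fun p q h => by simp [T, h]
  have hTdet : T.det = 1 := by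
    rw [det_prod_of_lower]
    · refine Finset.prod_eq_one fun i _ => ?_
      rw [← Matrix.det_one (n := Fin n)]
      congr 1
      ext a b
      by_cases hi : i = 0
      · subst hi
        rw [Matrix.of_apply, hT0]
        simp [hx0]
      · rw [Matrix.of_apply, hT1 _ _ hi]
        simp [Matrix.one_apply]
    · intro p q hpq
      have hq : q.1 ≠ 0 := ((Fin.zero_le _).trans_lt hpq).ne'
      rw [hT1 p q hq, Matrix.one_apply_ne]
      rintro rfl
      exact lt_irrefl _ hpq
  have hΔT : ∀ j a q, (Δ * T) (j + 1, a) q = T (j + 1, a) q - ∑ c, U j a c * T (j, c) q := by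
    intro j a q
    rw [Matrix.mul_apply]
    simp_rw [hΔ, sub_mul]
    rw [Finset.sum_sub_distrib]
    congr 1
    · simp [Matrix.one_apply]
    · rw [Fintype.sum_prod_type, Finset.sum_eq_single j]
      · simp
      · intro i _ hij
        simp [hij.symm]
      · simp
  have hcol0 : ∀ j a b, (Δ * T) (j + 1, a) (0, b) =
      if j = Fin.last m then (1 - x (m + 1)) a b else 0 := by
    intro j a b
    have h1 : ∑ c, U j a c * T (j, c) (0, b) = x (j + 1) a b := by
      rw [hx, Matrix.mul_apply]
      simp_rw [hT0]
    rw [hΔT, h1, hT0]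
    refine Fin.lastCases ?_ (fun i => ?_) j
    · simp [Fin.last_add_one, hx0]
    · rw [if_neg (Fin.castSucc_lt_last i).ne, Fin.coeSucc_eq_succ]
      simp
  have hcol1 : ∀ j a q, q.1 ≠ 0 → (Δ * T) (j + 1, a) q =
      (1 : Matrix (Fin (m + 1) × Fin n) (Fin (m + 1) × Fin n) R) (j + 1, a) q -
        if j = q.1 then U j a q.2 else 0 := by
    intro j a q hq
    rw [hΔT, hT1 _ _ hq]
    congr 1
    simp_rw [hT1 _ _ hq]
    obtain ⟨q1, q2⟩ := q
    by_cases h : j = q1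
    · subst h
      simp [Matrix.one_apply]
    · simp [h]
  -- Shifting rows and columns cyclically by one moves block `0` to the end and makes `Δ * T` block
  -- lower triangular.
  let e : (Fin (m + 1) × Fin n) ≃ (Fin (m + 1) × Fin n) :=
    (Equiv.addRight 1).prodCongr (Equiv.refl _)
  have he : ∀ p q, (Δ * T).submatrix e e p q = (Δ * T) (p.1 + 1, p.2) (q.1 + 1, q.2) :=
    fun _ _ => rfl
  have hsucc : ∀ l : Fin (m + 1), l ≠ Fin.last m → l + 1 ≠ 0 ∧ l < l + 1 := by
    intro l
    refine Fin.lastCases (fun h => absurd rfl h) (fun i _ => ?_) l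
    rw [Fin.coeSucc_eq_succ]
    exact ⟨Fin.succ_ne_zero i, Fin.castSucc_lt_succ⟩
  rw [← mul_one Δ.det, ← hTdet, ← Matrix.det_mul, ← Matrix.det_submatrix_equiv_self e,
    det_prod_of_lower]
  · rw [Finset.prod_eq_single (Fin.last m)]
    · congr 1
      ext a b
      rw [Matrix.of_apply, he, Fin.last_add_one]
      have := hcol0 (Fin.last m) a b
      rwa [Fin.last_add_one, if_pos rfl] at this
    · intro l _ hl
      obtain ⟨h0, hlt⟩ := hsucc l hl
      rw [← Matrix.det_one (n := Fin n)]
      congr 1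
      ext a b
      rw [Matrix.of_apply, he, hcol1 _ _ _ h0, if_neg hlt.ne, sub_zero]
      simp [Matrix.one_apply]
    · simp
  · rintro ⟨j, a⟩ ⟨l, b⟩ hjl
    have hjl : j < l := hjl
    rw [he]
    by_cases hl : l = Fin.last m
    · subst hl
      rw [Fin.last_add_one, hcol0, if_neg hjl.ne]
    · obtain ⟨h0, hlt⟩ := hsucc l hl
      rw [hcol1 _ _ _ h0, if_neg (hjl.trans hlt).ne, sub_zero, Matrix.one_apply_ne]
      intro h
      exact hjl.ne (add_right_cancel (congrArg Prod.fst h))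

theorem node_zero (k : ℕ) : node k 0 = -1 := by simp [node]

theorem node_self {k : ℕ} (hk : k ≠ 0) : node k k = 0 := by
  have : (k : ℝ) ≠ 0 := by exact_mod_cast hk
  simp [node, this]

theorem node_mono (k : ℕ) : Monotone (node k) := fun i j h => by
  unfold node
  gcongr

theorem node_lt_node_succ {k : ℕ} (hk : k ≠ 0) (j : ℕ) : node k j < node k (j + 1) := by
  have : (0 : ℝ) < k := by exact_mod_cast Nat.pos_of_ne_zero hk
  unfold node
  gcongr
  exact Nat.lt_succ_self j

theorem cell_subset_Icc {k : ℕ} (hk : k ≠ 0) (j : ℕ) :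
    cell k j ⊆ Icc (node k j) (node k (j + 1)) := by
  unfold cell
  split_ifs with h
  · rw [h, node_self hk]
  · exact Ico_subset_Icc_self

theorem Ico_subset_cell {k : ℕ} (hk : k ≠ 0) (j : ℕ) :
    Ico (node k j) (node k (j + 1)) ⊆ cell k j := by
  unfold cell
  split_ifs with h
  · rw [h, node_self hk]
    exact Ico_subset_Icc_self
  · exact subset_rfl

theorem eq_of_mem_cell {k i j : ℕ} (hi : i < k) (hj : j < k) {t : ℝ} (hti : t ∈ cell k i)
    (htj : t ∈ cell k j) : i = j := by
  have hk : k ≠ 0 := by omega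
  have key : ∀ a b, a < b → b < k → t ∈ cell k a → t ∈ cell k b → False := by
    intro a b hab hb hta htb
    have h1 : node k (a + 1) ≤ t := (node_mono k hab).trans (cell_subset_Icc hk b htb).1
    rw [cell, if_neg (by omega)] at hta
    exact absurd hta.2 (not_lt.2 h1)
  rcases lt_trichotomy i j with h | h | h
  · exact (key i j h hj hti htj).elim
  · exact h
  · exact (key j i h hi htj hti).elim

theorem tendsto_of_eq_propagator {n : ℕ} {A : ℝ → Matrix (Fin n) (Fin n) ℝ} (hA : Continuous A)
    {k : ℕ} (hk : k ≠ 0) {j : ℕ} {μ : ℂ} {v : Fin n → ℂ} {y : ℝ → Fin n → ℂ}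
    (hy : ∀ t ∈ cell k j, y t = propagator A t (node k j) μ *ᵥ v) :
    Tendsto y (𝓝[<] (node k (j + 1)))
      (𝓝 (propagator A (node k (j + 1)) (node k j) μ *ᵥ v)) := by
  have hlt := node_lt_node_succ hk j
  have h := (continuousOn_propagator_mulVec hA hlt.le μ v) (node k (j + 1)) ⟨hlt.le, le_rfl⟩
  have h' := h.tendsto.mono_left (nhdsWithin_mono _ Ico_subset_Icc_self)
  rw [nhdsWithin_Ico_eq_nhdsLT hlt] at h'
  refine h'.congr' ?_
  filter_upwards [Ico_mem_nhdsLT hlt] with t ht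
  exact (hy t (Ico_subset_cell hk j ht)).symm

/-- At `z = 0` the delay term drops out and the cells decouple, so propagating each `v j` on its own
cell gives a solution without any bound on `k`. -/
theorem isMIVPSolution_mivpSolution_zero {n : ℕ} {A : ℝ → Matrix (Fin n) (Fin n) ℝ}
    (hA : Continuous A) (B : ℝ → Matrix (Fin n) (Fin n) ℝ) (τ : ℝ) (k : ℕ) (μ : ℂ)
    (v : Fin k → Fin n → ℂ) :
    IsMIVPSolution A B τ k μ 0 v (mivpSolution A B τ k μ 0 v) := by
  classical
  have hex : ∃ y, IsMIVPSolution A B τ k μ 0 v y := by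
    let y : ℝ → Fin n → ℂ := fun t => if h : ∃ j : Fin k, t ∈ cell k j then
      propagator A t (node k h.choose) μ *ᵥ v h.choose else 0
    have hy : ∀ j : Fin k, ∀ t ∈ cell k j, y t = propagator A t (node k j) μ *ᵥ v j := by
      intro j t ht
      have h : ∃ j : Fin k, t ∈ cell k j := ⟨j, ht⟩
      have hj : h.choose = j := Fin.ext (eq_of_mem_cell h.choose.2 j.2 h.choose_spec ht)
      simp only [y, dif_pos h, hj]
    refine ⟨y, fun j hj => ?_, fun j t ht => by rw [zero_smul, add_zero, hy j t ht]⟩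
    have hk : k ≠ 0 := by omega
    have hyj := hy ⟨j, hj⟩
    refine ⟨?_, _, tendsto_of_eq_propagator hA hk hyj⟩
    exact ((continuousOn_propagator_mulVec hA (node_lt_node_succ hk j).le μ _).mono
      (cell_subset_Icc hk j)).congr hyj
  rw [mivpSolution, dif_pos hex]
  exact hex.choose_spec

theorem charMap_zero {n : ℕ} {A : ℝ → Matrix (Fin n) (Fin n) ℝ}
    (hA : Continuous A) (B : ℝ → Matrix (Fin n) (Fin n) ℝ) (τ : ℝ) (m : ℕ) (μ : ℂ)
    (v : Fin (m + 1) → Fin n → ℂ) (j : Fin (m + 1)) :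
    charMap A B τ (m + 1) μ 0 v (j + 1) =
      v (j + 1) - propagator A (node (m + 1) (j + 1)) (node (m + 1) j) μ *ᵥ v j := by
  have hsol := isMIVPSolution_mivpSolution_zero hA B τ (m + 1) μ v
  set y := mivpSolution A B τ (m + 1) μ 0 v with hydef
  have hy : ∀ j : Fin (m + 1), ∀ t ∈ cell (m + 1) j,
      y t = propagator A t (node (m + 1) j) μ *ᵥ v j := fun j t ht => by
    rw [hsol.eqn j t ht, zero_smul, add_zero]
  have hk : m + 1 ≠ 0 := by omega
  unfold charMap
  rw [← hydef]
  congr 1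
  -- The last index wraps around to row `0`, which uses the value at `0`, attained because the last
  -- cell is closed; the other rows use left limits.
  refine Fin.lastCases ?_ (fun i => ?_) j
  · rw [Fin.last_add_one, if_pos (by simp)]
    have h0 : node (m + 1) (m + 1) = 0 := node_self hk
    have hmem : (0 : ℝ) ∈ cell (m + 1) (Fin.last m : Fin (m + 1)) := by
      rw [Fin.val_last, cell, if_pos rfl]
      exact ⟨h0 ▸ node_mono _ (Nat.le_succ m), le_rfl⟩
    rw [hy _ _ hmem, Fin.val_last, h0]
  · rw [Fin.coeSucc_eq_succ, if_neg (by simp)]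
    refine leftLim_eq_of_tendsto ?_
    have := tendsto_of_eq_propagator hA hk (hy i.castSucc)
    simpa using this

/-- At `z = 0`, the characteristic function is the characteristic polynomial of the monodromy
matrix of `x' = A x`, up to a change of variables. -/
theorem charFun_zero {n : ℕ} {A : ℝ → Matrix (Fin n) (Fin n) ℝ}
    (hA : Continuous A) (hper : Function.Periodic A 1) (B : ℝ → Matrix (Fin n) (Fin n) ℝ) (τ : ℝ)
    {m : ℕ} (hm : m ≠ 0) (μ : ℂ) :
    charFun A B τ m μ 0 = (1 - Complex.exp (-μ) • propagator A 1 0 0).det := by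
  obtain ⟨m, rfl⟩ := Nat.exists_eq_succ_of_ne_zero hm
  rw [← propagator_zero_neg_one hA hper, charFun,
    det_cyclic (m := m) (fun j => propagator A (node (m + 1) (j + 1)) (node (m + 1) j) μ)
      (fun j => propagator A (node (m + 1) j) (-1) μ)]
  · rw [node_self (by omega)]
  · simp only [node_zero, propagator_self hA]
  · intro j
    refine (propagator_mul_propagator hA ?_ ?_ μ).symm
    · rw [← node_zero (m + 1)]
      exact node_mono _ (Nat.zero_le _)
    · exact node_mono _ (Nat.le_succ _)
  · rintro j a ⟨q, b⟩
    rw [charMatrix, Matrix.of_apply, charMap_zero hA, Pi.sub_apply]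
    congr 1
    · simp only [Matrix.one_apply, Pi.single_apply, Prod.mk.injEq]
      by_cases h : j + 1 = q
      · simp [h, Pi.single_apply]
      · simp [h]
    · by_cases h : j = q
      · subst h
        simp
      · simp [h]

/-! ### The time-one map in a weighted norm. -/

theorem timeOneMap_apply_of_le {n : ℕ} {A B : ℝ → Matrix (Fin n) (Fin n) ℝ} (hA : Continuous A)
    (hB : Continuous B) {r : ℝ} (hr : 1 ≤ r) (φ : C(Icc (-r) 0, Fin n → ℂ)) (s : Icc (-r) 0)
    (hs : 1 + (s : ℝ) ∈ Icc (-r) 0) : timeOneMap A B r φ s = φ ⟨1 + s, hs⟩ := by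
  obtain ⟨x, hx, hM⟩ := isTimeOneMap_timeOneMap hA hB hr φ
  rw [hM]
  exact hx.history ⟨1 + s, hs⟩

theorem IsDDESolution.hasDerivWithinAt_zero {n : ℕ} {A : ℝ → Matrix (Fin n) (Fin n) ℝ} {r : ℝ}
    {φ : C(Icc (-r) 0, Fin n → ℂ)} {x : ℝ → Fin n → ℂ} (hx : IsDDESolution A 0 r φ x) :
    ∀ t ∈ Icc (0 : ℝ) 1, HasDerivWithinAt x (toComplex (A t) *ᵥ x t) (Icc 0 1) t := by
  intro t ht
  refine (hx.deriv t ht).congr_deriv ?_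
  have : toComplex ((0 : ℝ → Matrix (Fin n) (Fin n) ℝ) t) = 0 := by
    ext i j
    simp [toComplex]
  rw [this, Matrix.zero_mulVec, add_zero]

/-- Without the delay term the solution on `[0, 1]` depends on the history only through its value at
`0`; Gronwall gives a constant independent of `r`. -/
theorem exists_norm_timeOneMap_zero_le {n : ℕ} {A : ℝ → Matrix (Fin n) (Fin n) ℝ}
    (hA : Continuous A) : ∃ C : ℝ, 0 ≤ C ∧ ∀ (r : ℝ) (hr : 1 ≤ r)
      (φ : C(Icc (-r) 0, Fin n → ℂ)) (s : Icc (-r) 0), 0 ≤ 1 + (s : ℝ) →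
      ‖timeOneMap A 0 r φ s‖ ≤ C * ‖φ ⟨0, by linarith, le_rfl⟩‖ := by
  obtain ⟨K, hK0, hK⟩ := exists_norm_mulVec_le (continuous_toComplex hA) 0 1
  refine ⟨Real.exp K, (Real.exp_pos K).le, fun r hr φ s hs => ?_⟩
  obtain ⟨x, hx, hM⟩ := isTimeOneMap_timeOneMap hA continuous_zero hr φ
  have hs1 : 1 + (s : ℝ) ∈ Icc (0 : ℝ) 1 := ⟨hs, by linarith [s.2.2]⟩
  rw [hM, ← hx.history]
  have h := norm_le_gronwallBound_of_linear hK (y := x) (g := 0) (ε := 0) (by simp)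
    (by simpa using hx.hasDerivWithinAt_zero) _ hs1
  rw [gronwallBound_ε0, mul_comm] at h
  refine h.trans (mul_le_mul_of_nonneg_right (Real.exp_le_exp.2 ?_) (norm_nonneg _))
  nlinarith [hs1.2]

theorem timeOneMap_zero_apply_zero {n : ℕ} {A : ℝ → Matrix (Fin n) (Fin n) ℝ}
    (hA : Continuous A) {r : ℝ} (hr : 1 ≤ r) (φ : C(Icc (-r) 0, Fin n → ℂ)) :
    timeOneMap A 0 r φ ⟨0, by linarith, le_rfl⟩ =
      propagator A 1 0 0 *ᵥ φ ⟨0, by linarith, le_rfl⟩ := by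
  obtain ⟨x, hx, hM⟩ := isTimeOneMap_timeOneMap hA continuous_zero hr φ
  rw [hM, ← hx.history, add_zero]
  refine (propagator_mulVec hA zero_le_one ?_).symm
  simpa using hx.hasDerivWithinAt_zero

/-- The difference of the two solutions starts from zero and is forced by `B(t) x(t - r)`, which for
`t ≤ 1` involves only the oldest unit interval of the history. -/
theorem exists_norm_timeOneMap_sub_le {n : ℕ} {A B : ℝ → Matrix (Fin n) (Fin n) ℝ}
    (hA : Continuous A) (hB : Continuous B) : ∃ C : ℝ, 0 ≤ C ∧ ∀ (r : ℝ), 1 ≤ r →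
      ∀ (φ : C(Icc (-r) 0, Fin n → ℂ)) (b : ℝ), (∀ q : Icc (-r) 0, (q : ℝ) ≤ 1 - r → ‖φ q‖ ≤ b) →
      ∀ s : Icc (-r) 0, 0 ≤ 1 + (s : ℝ) →
      ‖timeOneMap A B r φ s - timeOneMap A 0 r φ s‖ ≤ C * b := by
  obtain ⟨K, hK0, hK⟩ := exists_norm_mulVec_le (continuous_toComplex hA) 0 1
  obtain ⟨K', hK'0, hK'⟩ := exists_norm_mulVec_le (continuous_toComplex hB) 0 1
  have he : 0 ≤ Real.exp (K * 1) - 1 := by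
    rw [sub_nonneg, Real.one_le_exp_iff]
    linarith
  refine ⟨K' / K * (Real.exp (K * 1) - 1), by positivity, fun r hr φ b hb s hs => ?_⟩
  have hb0 : 0 ≤ b :=
    (norm_nonneg _).trans (hb ⟨-r, le_rfl, by linarith⟩ (by change -r ≤ 1 - r; linarith))
  obtain ⟨x, hx, hM⟩ := isTimeOneMap_timeOneMap hA hB hr φ
  obtain ⟨x₀, hx₀, hM₀⟩ := isTimeOneMap_timeOneMap hA continuous_zero hr φ
  have hs1 : 1 + (s : ℝ) ∈ Icc (0 : ℝ) 1 := ⟨hs, by linarith [s.2.2]⟩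
  rw [hM, hM₀]
  have h := norm_le_gronwallBound_of_linear hK (y := x - x₀)
    (g := fun t => toComplex (B t) *ᵥ x (t - r)) (ε := K' * b)
    (fun t ht => by
      have hm : t - r ∈ Icc (-r) 0 := ⟨by linarith [ht.1], by linarith [ht.2]⟩
      refine (hK' t ht _).trans (mul_le_mul_of_nonneg_left ?_ hK'0.le)
      rw [hx.history ⟨t - r, hm⟩]
      exact hb _ (by change t - r ≤ 1 - r; linarith [ht.2]))
    (fun t ht => by
      refine ((hx.deriv t ht).sub (hx₀.hasDerivWithinAt_zero t ht)).congr_deriv ?_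
      simp only [Pi.sub_apply, Matrix.mulVec_sub]
      abel) _ hs1
  have h0 : (x - x₀) 0 = 0 := by
    have hm : (0 : ℝ) ∈ Icc (-r) 0 := ⟨by linarith, le_rfl⟩
    rw [Pi.sub_apply, hx.history ⟨0, hm⟩, hx₀.history ⟨0, hm⟩, sub_self]
  rw [h0, norm_zero, sub_zero] at h
  refine (h.trans (gronwallBound_mono le_rfl (by positivity) hK0.le hs1.2)).trans (le_of_eq ?_)
  rw [gronwallBound_of_K_ne_0 hK0.ne']
  ring

/-- Multiplication by the weight `exp (-g s)` on `C([-r, 0]; ℂⁿ)`. -/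
theorem exists_weight (n : ℕ) (r g : ℝ) :
    ∃ D : C(Icc (-r) 0, Fin n → ℂ) ≃L[ℂ] C(Icc (-r) 0, Fin n → ℂ),
      (∀ φ s, D φ s = Real.exp (-g * s) • φ s) ∧
      ∀ φ s, D.symm φ s = Real.exp (g * s) • φ s := by
  have key : ∀ g : ℝ, ∃ D : C(Icc (-r) 0, Fin n → ℂ) →L[ℂ] C(Icc (-r) 0, Fin n → ℂ),
      ∀ φ s, D φ s = Real.exp (g * s) • φ s := by
    intro g
    let w : C(Icc (-r) 0, ℝ) := ⟨fun s => Real.exp (g * s), by fun_prop⟩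
    let D₀ : C(Icc (-r) 0, Fin n → ℂ) →ₗ[ℂ] C(Icc (-r) 0, Fin n → ℂ) :=
      { toFun := fun φ => ⟨fun s => w s • φ s, by fun_prop⟩
        map_add' := fun φ ψ => by
          ext1 s
          exact smul_add _ _ _
        map_smul' := fun c φ => by
          ext1 s
          exact smul_comm (w s) c (φ s) }
    refine ⟨D₀.mkContinuous ‖w‖ fun φ => ?_, fun φ s => rfl⟩
    rw [ContinuousMap.norm_le _ (by positivity)]
    intro s
    change ‖w s • φ s‖ ≤ _
    rw [norm_smul]
    exact mul_le_mul (w.norm_coe_le_norm s) (φ.norm_coe_le_norm s) (norm_nonneg _) (norm_nonneg _)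
  obtain ⟨D₁, hD₁⟩ := key (-g)
  obtain ⟨D₂, hD₂⟩ := key g
  refine ⟨ContinuousLinearEquiv.equivOfInverse D₁ D₂ (fun φ => ?_) (fun φ => ?_), hD₁, hD₂⟩
  · ext1 s
    rw [hD₂, hD₁, smul_smul, ← Real.exp_add]
    simp
  · ext1 s
    rw [hD₁, hD₂, smul_smul, ← Real.exp_add]
    simp

/-- In a weighted norm, the time-`1` map is a perturbation of a block triangular operator, whose
distance tends to zero exponentially as the delay tends to infinity. -/
theorem exists_weighted_timeOneMap {n : ℕ} {A B : ℝ → Matrix (Fin n) (Fin n) ℝ}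
    (hA : Continuous A) (hB : Continuous B) {g : ℝ} (hg : 0 < g) :
    ∃ C K : ℝ, ∀ r : ℝ, 1 ≤ r →
      ∃ (D : C(Icc (-r) 0, Fin n → ℂ) ≃L[ℂ] C(Icc (-r) 0, Fin n → ℂ))
        (T₀ T : C(Icc (-r) 0, Fin n → ℂ) →L[ℂ] C(Icc (-r) 0, Fin n → ℂ))
        (E : C(Icc (-r) 0, Fin n → ℂ) →L[ℂ] (Fin n → ℂ))
        (ι : (Fin n → ℂ) →L[ℂ] C(Icc (-r) 0, Fin n → ℂ)),
        T = D.conjContinuousAlgEquiv (timeOneMap A B r) ∧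
        ‖T₀‖ ≤ C ∧ ‖E‖ ≤ C ∧ ‖ι‖ ≤ C ∧ (∀ v, E (ι v) = v) ∧
        (∀ φ, E (T₀ φ) = propagator A 1 0 0 *ᵥ E φ) ∧
        (∀ φ, E φ = 0 → ‖T₀ φ‖ ≤ Real.exp g * ‖φ‖) ∧
        ‖T - T₀‖ ≤ K * Real.exp (-g * r) := by
  obtain ⟨C₁, hC₁0, hC₁⟩ := exists_norm_timeOneMap_zero_le hA
  obtain ⟨C₂, hC₂0, hC₂⟩ := exists_norm_timeOneMap_sub_le hA hB
  -- In the second constant, one factor `exp g` bounds the weight on `[-1, 0]` and the other comes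
  -- from `exp (g (1 - r))`.
  refine ⟨Real.exp g * (1 + C₁) + 1, Real.exp g * C₂ * Real.exp g, fun r hr => ?_⟩
  obtain ⟨D, hD, hD'⟩ := exists_weight n r g
  set M := timeOneMap A B r with hM
  set M₀ := timeOneMap A 0 r with hM₀
  have hm : (0 : ℝ) ∈ Icc (-r) 0 := ⟨by linarith, le_rfl⟩
  have hconj : ∀ (S : C(Icc (-r) 0, Fin n → ℂ) →L[ℂ] C(Icc (-r) 0, Fin n → ℂ)) φ s,
      D.conjContinuousAlgEquiv S φ s = Real.exp (-g * s) • S (D.symm φ) s := fun S φ s => hD _ s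
  have hshift : ∀ φ (s : Icc (-r) 0), 1 + (s : ℝ) ≤ 0 →
      ‖D.conjContinuousAlgEquiv M₀ φ s‖ ≤ Real.exp g * ‖φ‖ := by
    intro φ s hs
    rw [hconj, hM₀, timeOneMap_apply_of_le hA continuous_zero hr _ _ ⟨by linarith [s.2.1], hs⟩,
      hD', smul_smul, ← Real.exp_add, norm_smul, Real.norm_of_nonneg (Real.exp_pos _).le]
    have : -g * (s : ℝ) + g * (1 + s) = g := by ring
    simp only [this]
    exact mul_le_mul_of_nonneg_left (φ.norm_coe_le_norm _) (Real.exp_pos _).le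
  have hweight : ∀ s : Icc (-r) 0, 0 ≤ 1 + (s : ℝ) → Real.exp (-g * s) ≤ Real.exp g := by
    intro s hs
    rw [Real.exp_le_exp]
    nlinarith
  have hhead : ∀ φ (s : Icc (-r) 0), 0 ≤ 1 + (s : ℝ) →
      ‖D.conjContinuousAlgEquiv M₀ φ s‖ ≤ Real.exp g * (C₁ * ‖φ ⟨0, hm⟩‖) := by
    intro φ s hs
    rw [hconj, norm_smul, Real.norm_of_nonneg (Real.exp_pos _).le]
    have h := hC₁ r hr (D.symm φ) s hs
    rw [hD', mul_zero, Real.exp_zero, one_smul] at h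
    exact mul_le_mul (hweight s hs) h (norm_nonneg _) (Real.exp_pos _).le
  let E : C(Icc (-r) 0, Fin n → ℂ) →L[ℂ] (Fin n → ℂ) := ContinuousMap.evalCLM ℂ ⟨0, hm⟩
  have hE : ∀ φ, E φ = φ ⟨0, hm⟩ := fun φ => rfl
  -- Any linear right inverse of `E` with norm bounded independently of `r` would serve.
  let ι₀ : (Fin n → ℂ) →ₗ[ℂ] C(Icc (-r) 0, Fin n → ℂ) :=
    { toFun := fun v => ⟨fun s => max 0 (1 + (s : ℝ)) • v, by fun_prop⟩
      map_add' := fun v w => by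
        ext1 s
        exact smul_add _ _ _
      map_smul' := fun c v => by
        ext1 s
        exact smul_comm _ _ _ }
  have hι₀ : ∀ v s, ι₀ v s = max 0 (1 + (s : ℝ)) • v := fun v s => rfl
  have hιb : ∀ v, ‖ι₀ v‖ ≤ 1 * ‖v‖ := by
    intro v
    rw [ContinuousMap.norm_le _ (by positivity)]
    intro s
    rw [hι₀, norm_smul, Real.norm_of_nonneg (le_max_left _ _)]
    exact mul_le_mul_of_nonneg_right (max_le zero_le_one (by linarith [s.2.2])) (norm_nonneg _)
  have hC0 : 1 ≤ Real.exp g * (1 + C₁) + 1 := by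
    have := Real.exp_pos g
    nlinarith [mul_nonneg this.le hC₁0]
  refine ⟨D, D.conjContinuousAlgEquiv M₀, _, E, ι₀.mkContinuous 1 hιb, rfl,
    ContinuousLinearMap.opNorm_le_bound _ (by positivity) fun φ => ?_,
    ContinuousLinearMap.opNorm_le_bound _ (by positivity) fun φ => ?_,
    (LinearMap.mkContinuous_norm_le _ zero_le_one _).trans hC0,
    fun v => ?_, fun φ => ?_, fun φ hφ => ?_,
    ContinuousLinearMap.opNorm_le_bound _ (by positivity) fun φ => ?_⟩
  · rw [ContinuousMap.norm_le _ (by positivity)]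
    intro s
    have hφ := norm_nonneg φ
    have he := Real.exp_pos g
    rcases le_total (1 + (s : ℝ)) 0 with hs | hs
    · refine (hshift φ s hs).trans ?_
      gcongr
      nlinarith [mul_nonneg he.le hC₁0]
    · refine (hhead φ s hs).trans ?_
      rw [← mul_assoc]
      refine mul_le_mul ?_ (φ.norm_coe_le_norm _) (norm_nonneg _) (by positivity)
      nlinarith
  · refine (φ.norm_coe_le_norm _).trans ?_
    exact le_mul_of_one_le_left (norm_nonneg _) hC0
  · change ι₀ v ⟨0, hm⟩ = v
    rw [hι₀]
    simp
  · rw [hE, hE, hconj]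
    simp only [mul_zero, Real.exp_zero, one_smul]
    rw [hM₀, timeOneMap_zero_apply_zero hA hr, hD', mul_zero, Real.exp_zero, one_smul]
  · rw [ContinuousMap.norm_le _ (by positivity)]
    intro s
    rcases le_total (1 + (s : ℝ)) 0 with hs | hs
    · exact hshift φ s hs
    · refine (hhead φ s hs).trans ?_
      rw [← hE, hφ, norm_zero, mul_zero, mul_zero]
      positivity
  · rw [ContinuousMap.norm_le _ (by positivity)]
    intro s
    rw [sub_apply, ContinuousMap.sub_apply, hconj, hconj, ← smul_sub]
    -- Where both maps merely shift the history they agree, so the error lives on `[-1, 0]`.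
    rcases le_total (1 + (s : ℝ)) 0 with hs | hs
    · have hs' : 1 + (s : ℝ) ∈ Icc (-r) 0 := ⟨by linarith [s.2.1], hs⟩
      rw [hM, hM₀, timeOneMap_apply_of_le hA hB hr _ _ hs',
        timeOneMap_apply_of_le hA continuous_zero hr _ _ hs', sub_self, smul_zero, norm_zero]
      positivity
    · rw [norm_smul, Real.norm_of_nonneg (Real.exp_pos _).le]
      have h := hC₂ r hr (D.symm φ) (Real.exp (g * (1 - r)) * ‖φ‖) (fun q hq => by
        rw [hD', norm_smul, Real.norm_of_nonneg (Real.exp_pos _).le]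
        refine mul_le_mul (Real.exp_le_exp.2 (mul_le_mul_of_nonneg_left hq hg.le))
          (φ.norm_coe_le_norm _) (norm_nonneg _) (Real.exp_pos _).le) s hs
      refine (mul_le_mul (hweight s hs) h (norm_nonneg _) (Real.exp_pos _).le).trans (le_of_eq ?_)
      have : g * (1 - r) = g + -g * r := by ring
      rw [this, Real.exp_add]
      ring

/-! ### Order of vanishing and algebraic multiplicity. -/

theorem analyticOrderAt_polynomial_eval (p : Polynomial ℂ) (hp : p ≠ 0) (a : ℂ) :
    analyticOrderAt (fun z => p.eval z) a = p.rootMultiplicity a := by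
  obtain ⟨q, hq, hq'⟩ := p.exists_eq_pow_rootMultiplicity_mul_and_not_dvd hp a
  have han : ∀ q : Polynomial ℂ, AnalyticAt ℂ (fun z => q.eval z) a := fun q =>
    AnalyticOnNhd.eval_polynomial q a trivial
  rw [(han p).analyticOrderAt_eq_natCast]
  refine ⟨fun z => q.eval z, han q, fun h => hq' (Polynomial.dvd_iff_isRoot.2 h),
    Eventually.of_forall fun z => ?_⟩
  conv_lhs => rw [hq]
  simp

/-- The monodromy operator of `x' = A x`. -/
def monodromy {n : ℕ} (A : ℝ → Matrix (Fin n) (Fin n) ℝ) : (Fin n → ℂ) →L[ℂ] (Fin n → ℂ) :=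
  LinearMap.toContinuousLinearMap (propagator A 1 0 0).toLin'

theorem charFun_zero_eq_charpoly {n : ℕ} {A : ℝ → Matrix (Fin n) (Fin n) ℝ}
    (hA : Continuous A) (hper : Function.Periodic A 1) (B : ℝ → Matrix (Fin n) (Fin n) ℝ) (τ : ℝ)
    {m : ℕ} (hm : m ≠ 0) (μ : ℂ) :
    charFun A B τ m μ 0 =
      Complex.exp (-μ) ^ n * (monodromy A).toLinearMap.charpoly.eval (Complex.exp μ) := by
  have h1 : (monodromy A).toLinearMap.charpoly = (propagator A 1 0 0).charpoly :=
    Matrix.charpoly_toLin' _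
  have h2 : (1 - Complex.exp (-μ) • propagator A 1 0 0) =
      Complex.exp (-μ) • (Matrix.scalar (Fin n) (Complex.exp μ) - propagator A 1 0 0) := by
    rw [smul_sub]
    congr 1
    rw [Matrix.scalar_apply, ← Matrix.smul_one_eq_diagonal, smul_smul, ← Complex.exp_add]
    simp
  rw [charFun_zero hA hper B τ hm, h1, Matrix.eval_charpoly, h2, Matrix.det_smul, Fintype.card_fin]

/-- The factor `exp (-μ) ^ n` has no zeros, and composing with `exp`, whose derivative never
vanishes, preserves the order of a root of the characteristic polynomial. -/
theorem analyticOrderAt_charFun_zero {n : ℕ} {A : ℝ → Matrix (Fin n) (Fin n) ℝ}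
    (hA : Continuous A) (hper : Function.Periodic A 1) (B : ℝ → Matrix (Fin n) (Fin n) ℝ) (τ : ℝ)
    {m : ℕ} (hm : m ≠ 0) (μ₀ : ℂ) :
    analyticOrderAt (fun μ => charFun A B τ m μ 0) μ₀ =
      Module.finrank ℂ (Module.End.maxGenEigenspace (monodromy A).toLinearMap
        (Complex.exp μ₀)) := by
  set p := (monodromy A).toLinearMap.charpoly with hp
  have hp0 : p ≠ 0 := (LinearMap.charpoly_monic _).ne_zero
  have hfun : (fun μ => charFun A B τ m μ 0) =
      (fun μ => Complex.exp (-μ) ^ n) * ((fun z => p.eval z) ∘ Complex.exp) := by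
    funext μ
    exact charFun_zero_eq_charpoly hA hper B τ hm μ
  have han1 : AnalyticAt ℂ (fun μ => Complex.exp (-μ) ^ n) μ₀ := by fun_prop
  have han2 : AnalyticAt ℂ ((fun z => p.eval z) ∘ Complex.exp) μ₀ := by
    refine AnalyticAt.comp ?_ (by fun_prop)
    exact AnalyticOnNhd.eval_polynomial p _ trivial
  rw [LinearMap.finrank_maxGenEigenspace_eq, hfun, analyticOrderAt_mul han1 han2,
    han1.analyticOrderAt_eq_zero.2 (pow_ne_zero _ (Complex.exp_ne_zero _)), zero_add,
    analyticOrderAt_comp_of_deriv_ne_zero (by fun_prop) (by simp [Complex.exp_ne_zero]),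
    analyticOrderAt_polynomial_eval p hp0]

/-! ### Transfer along conjugation and along the exponential. -/

theorem map_maxGenEigenspace_of_conj {V W : Type*} [AddCommGroup V] [Module ℂ V]
    [AddCommGroup W] [Module ℂ W] (D : V ≃ₗ[ℂ] W) {f : Module.End ℂ V} {g : Module.End ℂ W}
    (h : ∀ x, g (D x) = D (f x)) (lam : ℂ) :
    (f.maxGenEigenspace lam).map D.toLinearMap = g.maxGenEigenspace lam := by
  have hpow : ∀ (k : ℕ) x, ((g - lam • (1 : Module.End ℂ W)) ^ k) (D x) =
      D (((f - lam • (1 : Module.End ℂ V)) ^ k) x) := by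
    intro k
    induction k with
    | zero => intro x; rfl
    | succ k ih =>
      intro x
      rw [pow_succ, Module.End.mul_apply, pow_succ, Module.End.mul_apply, ← ih]
      simp [h]
  ext y
  obtain ⟨x, rfl⟩ := D.surjective y
  rw [Submodule.mem_map_equiv, D.symm_apply_apply, Module.End.mem_maxGenEigenspace,
    Module.End.mem_maxGenEigenspace]
  simp [hpow]

theorem hasEigenvalue_iff_of_conj {V W : Type*} [AddCommGroup V] [Module ℂ V]
    [AddCommGroup W] [Module ℂ W] (D : V ≃ₗ[ℂ] W) {f : Module.End ℂ V} {g : Module.End ℂ W}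
    (h : ∀ x, g (D x) = D (f x)) (lam : ℂ) : f.HasEigenvalue lam ↔ g.HasEigenvalue lam := by
  constructor
  · intro hf
    obtain ⟨x, hx, hx0⟩ := hf.exists_hasEigenvector
    refine Module.End.hasEigenvalue_of_hasEigenvector (x := D x)
      ⟨Module.End.mem_genEigenspace_one.2 ?_, by simpa using hx0⟩
    rw [h, Module.End.mem_genEigenspace_one.1 hx, map_smul]
  · intro hg
    obtain ⟨y, hy, hy0⟩ := hg.exists_hasEigenvector
    obtain ⟨x, rfl⟩ := D.surjective y
    refine Module.End.hasEigenvalue_of_hasEigenvector (x := x)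
      ⟨Module.End.mem_genEigenspace_one.2 (D.injective ?_), by simpa using hy0⟩
    rw [← h, Module.End.mem_genEigenspace_one.1 hy, map_smul]

/-- Two points of the ball differ by less than `2`, hence by less than the period `2π`. Thus
distinct exponents in `U` give distinct eigenvalues and none is counted twice. -/
theorem injOn_exp_ball (a : ℂ) : InjOn Complex.exp (Metric.ball a 1) := by
  intro x hx y hy h
  obtain ⟨k, hk⟩ := Complex.exp_eq_exp_iff_exists_int.1 h
  have h1 : ‖x - y‖ < 2 := by
    rw [Metric.mem_ball, dist_eq_norm] at hx hy
    have : x - y = (x - a) - (y - a) := by ring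
    rw [this]
    exact (norm_sub_le _ _).trans_lt (by linarith)
  have h2 : ‖x - y‖ = |(k : ℝ)| * (2 * Real.pi) := by
    rw [hk, add_sub_cancel_left]
    simp [abs_of_pos Real.pi_pos]
  have hk0 : k = 0 := by
    by_contra hne
    have h3 : (1 : ℝ) ≤ |(k : ℝ)| := by exact_mod_cast Int.one_le_abs hne
    have h4 := Real.pi_gt_three
    nlinarith
  simpa [hk0] using hk

/-- The weighted perturbation estimates hold with an arbitrarily small error for large delays. -/
theorem exists_weighted_timeOneMap_of_lt {n : ℕ} {A B : ℝ → Matrix (Fin n) (Fin n) ℝ}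
    (hA : Continuous A) (hB : Continuous B) {τ : ℝ} (hτ : 0 ≤ τ) {g : ℝ} (hg : 0 < g) :
    ∃ C : ℝ, ∀ η : ℝ, 0 < η → ∃ N₀ : ℕ, ∀ N : ℕ, N₀ < N →
      ∃ (X : Type) (_ : NormedAddCommGroup X) (_ : NormedSpace ℂ X) (_ : CompleteSpace X)
        (D : C(Icc (-(τ + N)) 0, Fin n → ℂ) ≃L[ℂ] X)
        (T₀ : X →L[ℂ] X) (E : X →L[ℂ] (Fin n → ℂ)) (ι : (Fin n → ℂ) →L[ℂ] X),
        ‖T₀‖ ≤ C ∧ ‖E‖ ≤ C ∧ ‖ι‖ ≤ C ∧ (∀ v, E (ι v) = v) ∧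
        (∀ φ, E (T₀ φ) = monodromy A (E φ)) ∧
        (∀ φ, E φ = 0 → ‖T₀ φ‖ ≤ Real.exp g * ‖φ‖) ∧
        ‖D.conjContinuousAlgEquiv (timeOneMap A B (τ + N)) - T₀‖ ≤ η := by
  obtain ⟨C, K, hCK⟩ := exists_weighted_timeOneMap hA hB hg
  refine ⟨C, fun η hη => ?_⟩
  have hlim : Tendsto (fun N : ℕ => K * Real.exp (-g * (τ + N))) atTop (𝓝 (K * 0)) := by
    refine Tendsto.const_mul K (Real.tendsto_exp_atBot.comp ?_)
    exact (tendsto_atTop_add_const_left _ τ tendsto_natCast_atTop_atTop).const_mul_atTop_of_neg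
      (neg_lt_zero.2 hg)
  rw [mul_zero] at hlim
  obtain ⟨N₀, hN₀⟩ := eventually_atTop.1 (hlim.eventually_le_const hη)
  refine ⟨N₀, fun N hN => ?_⟩
  -- The strict inequality `N₀ < N` gives `N ≥ 1`, so the delay covers the whole time step.
  have hr : 1 ≤ τ + N := by
    have : (1 : ℝ) ≤ N := by exact_mod_cast (Nat.succ_le_of_lt ((Nat.zero_le _).trans_lt hN))
    linarith
  obtain ⟨D, T₀, T, E, ι, rfl, h1, h2, h3, h4, h5, h6, h7⟩ := hCK (τ + N) hr
  exact ⟨_, _, _, inferInstance, D, T₀, E, ι, h1, h2, h3, h4, h5, h6, h7.trans (hN₀ N hN.le)⟩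

section

attribute [local instance] Matrix.linftyOpNormedAddCommGroup

theorem maxNorm_nonneg {n : ℕ} (A : ℝ → Matrix (Fin n) (Fin n) ℝ) : 0 ≤ maxNorm A :=
  Real.sSup_nonneg (by
    rintro _ ⟨t, -, rfl⟩
    exact norm_nonneg _)

end

theorem ne_zero_of_partitionBound_lt {n : ℕ} {A B : ℝ → Matrix (Fin n) (Fin n) ℝ} {R : ℝ}
    (hR : 0 < R) {m : ℕ} (hm : partitionBound A B R < m) : m ≠ 0 := by
  rintro rfl
  have h1 : 0 ≤ maxNorm A := maxNorm_nonneg A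
  have h2 : maxNorm A + R ≤ partitionBound A B R := le_max_left _ _
  rw [Nat.cast_zero] at hm
  linarith

end DelayFloquet

end

open DelayFloquet

/-! ### Conclusion: strongly unstable exponents for large delay. -/

theorem mainTheorem3 {n : ℕ} (A B : ℝ → Matrix (Fin n) (Fin n) ℝ)
    (hA : Continuous A) (hB : Continuous B)
    (hAper : Function.Periodic A 1) (hBper : Function.Periodic B 1)
    (τ : ℝ) (hτ : τ ∈ Set.Ico (0 : ℝ) 1)
    (R : ℝ) (hR : 0 < R) (m : ℕ) (hm : DelayFloquet.partitionBound A B R < m)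
    (μ₀ : ℂ) (hμ₀ : 0 < μ₀.re) :
    (DelayFloquet.charFun A B τ m μ₀ 0 ≠ 0 →
      ∃ N₀ : ℕ, ∀ N : ℕ, N₀ < N →
        Complex.exp μ₀ ∈ resolventSet ℂ (DelayFloquet.timeOneMap A B (τ + N))) ∧
    (∀ k : ℕ, 1 ≤ k → analyticOrderAt (fun μ => DelayFloquet.charFun A B τ m μ 0) μ₀ = k →
      ∃ δ : ℝ, 0 < δ ∧ ∀ U ∈ 𝓝 μ₀, U ⊆ Metric.ball μ₀ δ →
        ∃ N₀ : ℕ, ∀ N : ℕ, N₀ < N →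
          (U ∩ DelayFloquet.floquetExponents (DelayFloquet.timeOneMap A B (τ + N))).Finite ∧
          (∀ μ ∈ U, FiniteDimensional ℂ
            (DelayFloquet.floquetSpace (DelayFloquet.timeOneMap A B (τ + N)) μ)) ∧
          ∑ᶠ μ ∈ U ∩ DelayFloquet.floquetExponents (DelayFloquet.timeOneMap A B (τ + N)),
            Module.finrank ℂ
              (DelayFloquet.floquetSpace (DelayFloquet.timeOneMap A B (τ + N)) μ) = k) := by
  have hm0 : m ≠ 0 := ne_zero_of_partitionBound_lt hR hm
  have hg : 0 < μ₀.re / 2 := half_pos hμ₀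
  have hρ : Real.exp (μ₀.re / 2) < ‖Complex.exp μ₀‖ := by
    rw [Complex.norm_exp, Real.exp_lt_exp]
    linarith
  have hρ0 : 0 ≤ Real.exp (μ₀.re / 2) := (Real.exp_pos _).le
  obtain ⟨C, hC⟩ := exists_weighted_timeOneMap_of_lt hA hB hτ.1 hg
  constructor
  · intro hne
    have hev : ¬ Module.End.HasEigenvalue (monodromy A).toLinearMap (Complex.exp μ₀) := by
      rw [Module.End.hasEigenvalue_iff_isRoot_charpoly]
      intro h
      refine hne ?_
      rw [charFun_zero_eq_charpoly hA hAper B τ hm0, h.eq_zero, mul_zero]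
    obtain ⟨η, hη, hmain⟩ :=
      exists_mem_resolventSet_of_norm_sub_le (monodromy A) hev hρ0 hρ C
    obtain ⟨N₀, hN₀⟩ := hC η hη
    refine ⟨N₀, fun N hN => ?_⟩
    obtain ⟨X, _, _, _, D, T₀, E, ι, h1, h2, h3, h4, h5, h6, h7⟩ := hN₀ N hN
    by_contra hmem
    have hspec : Complex.exp μ₀ ∈ spectrum ℂ (timeOneMap A B (τ + N)) := hmem
    have hs : spectrum ℂ (D.conjContinuousAlgEquiv (timeOneMap A B (τ + N))) =
        spectrum ℂ (timeOneMap A B (τ + N)) :=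
      AlgEquiv.spectrum_eq D.conjContinuousAlgEquiv.toAlgEquiv _
    rw [← hs] at hspec
    exact hspec (hmain X T₀ _ E ι h1 h2 h3 h4 h5 h6 h7)
  · intro k _ hk
    rw [analyticOrderAt_charFun_zero hA hAper B τ hm0, Nat.cast_inj] at hk
    obtain ⟨ρ₀, hρ₀, hmain⟩ := exists_finsum_finrank_eq_of_norm_sub_le (monodromy A)
      (Complex.exp μ₀) hρ0 hρ C
    obtain ⟨δ, hδ, hδball⟩ := Metric.continuousAt_iff.1 Complex.continuous_exp.continuousAt ρ₀ hρ₀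
    -- `δ` keeps `exp '' U` inside the disc of radius `ρ₀`; the bound `1` makes `exp` injective on
    -- `U`.
    refine ⟨min δ 1, by positivity, fun U hU hUδ => ?_⟩
    have hinj : InjOn Complex.exp U :=
      (injOn_exp_ball μ₀).mono (hUδ.trans (Metric.ball_subset_ball (min_le_right _ _)))
    have hD₀ : Complex.exp '' U ⊆ Metric.ball (Complex.exp μ₀) ρ₀ := by
      rintro _ ⟨μ, hμ, rfl⟩
      exact hδball (Metric.ball_subset_ball (min_le_left _ _) (hUδ hμ))
    -- Local openness of `exp` supplies the inner disc; its radius depends on `U`, and so do `η` and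
    -- `N₀`.
    have hnhds : Complex.exp '' U ∈ 𝓝 (Complex.exp μ₀) := by
      rw [← (Complex.hasStrictDerivAt_exp μ₀).map_nhds_eq (Complex.exp_ne_zero _)]
      exact image_mem_map hU
    obtain ⟨ρ', hρ', hball⟩ := Metric.nhds_basis_closedBall.mem_iff.1 hnhds
    have hD₁ : Metric.closedBall (Complex.exp μ₀) (min ρ' ρ₀) ⊆ Complex.exp '' U :=
      (Metric.closedBall_subset_closedBall (min_le_left _ _)).trans hball
    obtain ⟨η, hη, hmain⟩ := hmain (min ρ' ρ₀) (lt_min hρ' hρ₀) (min_le_right _ _)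
    obtain ⟨N₀, hN₀⟩ := hC η hη
    refine ⟨N₀, fun N hN => ?_⟩
    obtain ⟨X, _, _, _, D, T₀, E, ι, h1, h2, h3, h4, h5, h6, h7⟩ := hN₀ N hN
    obtain ⟨hfin, hfd, hsum⟩ := hmain X T₀ _ E ι h1 h2 h3 h4 h5 h6 h7 _ hD₁ hD₀
    set M := timeOneMap A B (τ + N) with hM
    set T := D.conjContinuousAlgEquiv M with hT
    have hconj : ∀ x, (T : X →ₗ[ℂ] X) (D.toLinearEquiv x) =
        D.toLinearEquiv ((M : _ →ₗ[ℂ] _) x) := fun x => by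
      change D (M (D.symm (D x))) = D (M x)
      rw [D.symm_apply_apply]
    have himage : Complex.exp '' (U ∩ floquetExponents M) =
        Complex.exp '' U ∩ {lam | Module.End.HasEigenvalue (T : X →ₗ[ℂ] X) lam} := by
      ext lam
      constructor
      · rintro ⟨μ, ⟨hμ, hev⟩, rfl⟩
        exact ⟨⟨μ, hμ, rfl⟩, (hasEigenvalue_iff_of_conj _ hconj _).1 hev⟩
      · rintro ⟨⟨μ, hμ, rfl⟩, hev⟩
        exact ⟨μ, ⟨hμ, (hasEigenvalue_iff_of_conj _ hconj _).2 hev⟩, rfl⟩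
    have hspace : ∀ μ, Nonempty (floquetSpace M μ ≃ₗ[ℂ]
        Module.End.maxGenEigenspace (T : X →ₗ[ℂ] X) (Complex.exp μ)) := fun μ => by
      rw [← map_maxGenEigenspace_of_conj _ hconj]
      exact ⟨D.toLinearEquiv.submoduleMap _⟩
    refine ⟨?_, fun μ hμ => ?_, ?_⟩
    · rw [← himage] at hfin
      exact hfin.of_finite_image (hinj.mono inter_subset_left)
    · obtain ⟨e⟩ := hspace μ
      have := hfd _ (mem_image_of_mem _ hμ)
      exact e.symm.finiteDimensional
    · rw [← hk, ← hsum, ← himage, finsum_mem_image (hinj.mono inter_subset_left)]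
      refine finsum_mem_congr rfl fun μ _ => ?_
      obtain ⟨e⟩ := hspace μ
      exact e.finrank_eq
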